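/- Let $X$ be a finite connected multigraph (loops and multiple edges are allowed) with vertex set $V$ and edge set $E$, none of whose vertices has degree one, a loop being counted twice in the degree. Every edge $e$, loops included, has two orientations, denoted $e$ and $e^{-1}$. A closed path $e_1\cdots e_m$ ($m\ge 1$) of oriented edges is called a prime path if $e_{i+1}\neq e_i^{-1}$ for $1\le i<m$, $e_1\neq e_m^{-1}$, and it is not of the form $C^a$ for a closed path $C$ and an integer $a\ge 2$. A prime $\mathfrak p$ of $X$ is a class of prime paths up to cyclic rotation, and $\nu(\mathfrak p)$ denotes its length. Let $\kappa_X$ be the number of spanning trees of $X$ and put $r=|E|-|V|+1$. Assume that $r\neq 1$. There exists a meromorphic function $\zeta_X$ on $\mathbb C$, the Ihara zeta function of $X$, that for all sufficiently small $|u|$ is given by the convergent product $$\zeta_X(u)=\prod_{\mathfrak p}\bigl(1-u^{\nu(\mathfrak p)}\bigr)^{-1}$$ over all primes of $X$; it is unique by the identity theorem. Moreover, $$\operatorname{ord}_{u=1}\bigl(\zeta_X(u)^{-1}\bigr)=r,$$ and the first non-vanishing Taylor coefficient of $\zeta_X(u)^{-1}$ at $u=1$, that is, the coefficient of $(u-1)^r$,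 equals $$(-1)^{r+1}\cdot 2^{r}\cdot (r-1)\cdot\kappa_X .$$ -/

import Mathlib

/-! Multigraphs are Mathlib's `Graph α β` (loops and parallel edges are allowed). -/

noncomputable section

namespace Graph

universe u v

variable {α : Type u} {β : Type v}

/-- An oriented edge of `G`. Every edge, loops included, carries exactly two orientations, labelled
by `Bool` relative to a reference orientation chosen for each edge. -/
structure Dart (G : Graph α β) where
  edge : G.edgeSet
  dir : Bool

/-- First end of `e` in its reference orientation. -/
def refSrc (G : Graph α β) (e : G.edgeSet) : α :=
  (G.exists_isLink_of_mem_edgeSet e.2).choose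

/-- Second end of `e` in its reference orientation. -/
def refTgt (G : Graph α β) (e : G.edgeSet) : α :=
  (G.exists_isLink_of_mem_edgeSet e.2).choose_spec.choose

theorem isLink_ref (G : Graph α β) (e : G.edgeSet) : G.IsLink e (G.refSrc e) (G.refTgt e) :=
  (G.exists_isLink_of_mem_edgeSet e.2).choose_spec.choose_spec

namespace Dart

variable {G : Graph α β}

/-- The initial vertex of an oriented edge. -/
def src (d : G.Dart) : α := if d.dir then G.refSrc d.edge else G.refTgt d.edge

/-- The terminal vertex of an oriented edge. -/
def tgt (d : G.Dart) : α := if d.dir then G.refTgt d.edge else G.refSrc d.edge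

/-- The same edge with the opposite orientation. -/
def rev (d : G.Dart) : G.Dart := ⟨d.edge, !d.dir⟩

end Dart

/-- `G.IsPath x y [e₁, …, eₘ]` means that `e₁ ⋯ eₘ` is a path from `x` to `y`: the initial vertex
of `e₁` is `x`, the terminal vertex of `eᵢ` is the initial vertex of `eᵢ₊₁`, and the terminal
vertex of `eₘ` is `y`. The empty list is the trivial path from a vertex to itself. -/
def IsPath (G : Graph α β) : α → α → List G.Dart → Prop
  | x, y, [] => x = y
  | x, y, e :: l => e.src = x ∧ G.IsPath e.tgt y l

/-- Any two vertices are joined by a path. -/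
def Connected (G : Graph α β) : Prop :=
  ∀ x ∈ G.vertexSet, ∀ y ∈ G.vertexSet, ∃ l : List G.Dart, G.IsPath x y l

/-- The number of edges incident to `x`, a loop being counted twice. -/
def degree (G : Graph α β) (x : α) : ℕ :=
  {e : β | G.Inc e x}.ncard + {e : β | G.IsLoopAt e x}.ncard

/-- A closed path of length at least one. -/
def IsClosedPath (G : Graph α β) (l : List G.Dart) : Prop :=
  l ≠ [] ∧ ∃ x, G.IsPath x x l

/-- A cycle: a closed path on which no edge is repeated (independently of the orientation) and
the terminal vertices of the oriented edges are pairwise distinct. -/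
def IsCycle (G : Graph α β) (l : List G.Dart) : Prop :=
  G.IsClosedPath l ∧ (l.map Dart.edge).Nodup ∧ (l.map Dart.tgt).Nodup

/-- `T` is a spanning tree of `G`: a connected subgraph with all vertices of `G` and no cycles. -/
def IsSpanningTree (G T : Graph α β) : Prop :=
  T.IsSpanningSubgraph G ∧ T.Connected ∧ ∀ l : List T.Dart, ¬ T.IsCycle l

/-- The number `κ` of spanning trees of `G`. -/
def numSpanningTrees (G : Graph α β) : ℕ :=
  {T : Graph α β | G.IsSpanningTree T}.ncard

/-- The integer `|E| - |V| + 1`. -/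
def cycleRank (G : Graph α β) : ℤ :=
  (G.edgeSet.ncard : ℤ) - (G.vertexSet.ncard : ℤ) + 1

/-- A prime path: a closed path without backtracks and without a tail that is not a proper power
of a closed path. -/
structure IsPrimePath (G : Graph α β) (l : List G.Dart) : Prop where
  closed : G.IsClosedPath l
  no_backtrack : l.IsChain (fun e f => f ≠ e.rev)
  no_tail : ∀ h : l ≠ [], l.head h ≠ (l.getLast h).rev
  primitive : ∀ (c : List G.Dart) (a : ℕ), G.IsClosedPath c → 2 ≤ a →
    l ≠ (List.replicate a c).flatten

/-- The primes of `G`: classes of prime paths up to rotation, i.e. up to the choice of the starting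
point. (`Cycle` is Mathlib's type of lists up to rotation.) -/
def Prime (G : Graph α β) : Type v :=
  {c : Cycle G.Dart // ∃ l : List G.Dart, G.IsPrimePath l ∧ (l : Cycle G.Dart) = c}

/-- The length `ν(𝔭)` of a prime, i.e. the common length of the paths in its class. -/
def Prime.length {G : Graph α β} (p : G.Prime) : ℕ := Cycle.length p.1

/-- `Z` is the Ihara zeta function of `G`: a meromorphic function on `ℂ` that is given near `0` by
the convergent product of `(1 - u ^ ν(𝔭))⁻¹` over all primes `𝔭` of `G`. By the identity theorem
such a `Z` is unique up to its values on a closed discrete set, which affect neither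
orders nor leading coefficients. -/
def IsIharaZeta (G : Graph α β) (Z : ℂ → ℂ) : Prop :=
  Meromorphic Z ∧ ∃ ε : ℝ, 0 < ε ∧ ∀ u : ℂ, ‖u‖ < ε →
    HasProd (fun p : G.Prime => (1 - u ^ p.length)⁻¹) (Z u)

end Graph

end

/-! The reciprocal of the zeta function is det(1 - uB), where B is the matrix of the relation "f may
follow e without backtracking". Every nonempty closed chain is uniquely a power of a primitive one,
and a primitive chain of length ν has ν distinct rotations. Hence the sum of -log(1 - u^ν) over
primes equals the sum of u^|w|/|w| over closed chains w, which is ∑ tr(B^k) u^k/k = -log det(1 - uB)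
for small u (`hasSum_neg_log_primeCycle`, `hasSum_trace_relMatrix`, `exists_exp_mul_det_eq_one`).
The determinant supplies the continuation; the identity theorem transfers the result to any other
choice of zeta function.

Bass's formula `det_one_sub_smul_edgeMatrix` gives det(1 - uB) = (1 - u²)^(r-1) det((1 - u²) - uA +
u²Δ) where 1 - u² ≠ 0. The rows of the last matrix sum to (1 - u)(1 + u - u deg v), so its
determinant is (1 - u) b(u). At u = 1 the matrix is the Laplacian, whose adjugate has all entries κ
by the matrix-tree theorem, and Cramer's rule yields b(1) = κ ∑ (2 - deg v) = -2(r - 1)κ. This is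
nonzero for r ≠ 1 and X connected, so order and leading coefficient can be read off. -/

open Finset

/-! ### The matrix-tree theorem for directed graphs -/

section MatrixTree

variable {V D : Type*} [DecidableEq V]

/-- `f` assigns to every vertex `v ≠ v₀` an arrow leaving `v`, and following these arrows strictly
decreases a rank function, so that they form a spanning tree oriented towards the root `v₀`. -/
def IsArborescence (src tgt : D → V) (v₀ : V) (f : V → Option D) : Prop :=
  f v₀ = none ∧ (∀ v, v ≠ v₀ → ∃ d, f v = some d ∧ src d = v) ∧
    ∃ δ : V → ℕ, ∀ v d, f v = some d → δ (tgt d) < δ v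

/-- The Laplacian `∑ d, (e_{src d} - e_{tgt d})` (as rows) of a finite directed graph. -/
def dirLaplacian [Fintype D] (src tgt : D → V) : Matrix V V ℂ :=
  Matrix.of fun v => ∑ d with src d = v, (Pi.single v 1 - Pi.single (tgt d) 1)

/-- The row of the Laplacian contributed by an arrow, or the row of the identity. -/
def arrowRow (tgt : D → V) (v : V) (o : Option D) : V → ℂ :=
  Pi.single v 1 - o.elim 0 fun d => Pi.single (tgt d) 1

/-- The only off-diagonal entry of a row sits at a vertex of smaller rank, so ordering by `δ` makes
the matrix unitriangular. -/
theorem det_arrowRow_of_rank [Fintype V] (tgt : D → V) (f : V → Option D) (δ : V → ℕ)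
    (hδ : ∀ v d, f v = some d → δ (tgt d) < δ v) :
    (Matrix.of fun v => arrowRow tgt v (f v)).det = 1 := by
  have key : ∀ v w, δ v ≤ δ w → arrowRow tgt v (f v) w = (1 : Matrix V V ℂ) v w := by
    intro v w hvw
    rw [arrowRow, Matrix.one_apply]
    cases h : f v with
    | none => simp [Pi.single_apply, eq_comm]
    | some d =>
      have hne : w ≠ tgt d := by
        rintro rfl
        exact absurd (hδ v d h) (not_lt.2 hvw)
      simp [Pi.single_apply, eq_comm (a := w) (b := v), hne]
  have hT : (Matrix.of fun v => arrowRow tgt v (f v)).BlockTriangular (OrderDual.toDual ∘ δ) := by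
    intro v w hvw
    have hvw' : δ v < δ w := hvw
    rw [Matrix.of_apply, key v w hvw'.le, Matrix.one_apply_ne]
    rintro rfl
    exact lt_irrefl _ hvw'
  rw [hT.det]
  refine prod_eq_one fun a _ => ?_
  have : (Matrix.of fun v => arrowRow tgt v (f v)).toSquareBlock (OrderDual.toDual ∘ δ) a = 1 := by
    ext ⟨v, hv⟩ ⟨w, hw⟩
    have hvw : δ v = δ w := OrderDual.toDual.injective (hv.trans hw.symm)
    rw [Matrix.toSquareBlock_def, Matrix.of_apply, Matrix.of_apply, key v w hvw.le,
      Matrix.one_apply, Matrix.one_apply]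
    simp
  rw [this, Matrix.det_one]

/-- Without a rank function some vertex never reaches `v₀` along the arrows. The indicator of the
set of such vertices lies in the kernel. -/
theorem det_arrowRow_of_not_rank [Fintype V] (tgt : D → V) (v₀ : V) (f : V → Option D) (h₀ : f v₀ = none)
    (hf : ∀ v, v ≠ v₀ → ∃ d, f v = some d)
    (hδ : ¬ ∃ δ : V → ℕ, ∀ v d, f v = some d → δ (tgt d) < δ v) :
    (Matrix.of fun v => arrowRow tgt v (f v)).det = 0 := by
  classical
  let g : V → V := fun v => (f v).elim v₀ tgt
  let S : Set V := {v | ∀ n, g^[n] v ≠ v₀}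
  have hS : S.Nonempty := by
    by_contra hS
    have hreach : ∀ v, ∃ n, g^[n] v = v₀ := by
      intro v
      by_contra! hv
      exact hS ⟨v, hv⟩
    -- If every vertex reached `v₀`, the number of steps needed would be a rank function.
    refine hδ ⟨fun v => Nat.find (hreach v), fun v d hd => ?_⟩
    have hgv : g v = tgt d := by simp [g, hd]
    have hspec := Nat.find_spec (hreach v)
    rcases hn : Nat.find (hreach v) with _ | n
    · rw [hn] at hspec
      have : v = v₀ := hspec
      rw [this, h₀] at hd
      cases hd
    · rw [hn, Function.iterate_succ_apply, hgv] at hspec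
      have := Nat.find_min' (hreach (tgt d)) hspec
      dsimp only
      lia
  have hSg : ∀ v, v ≠ v₀ → (v ∈ S ↔ g v ∈ S) := by
    intro v hv
    constructor
    · intro h n
      have := h (n + 1)
      rwa [Function.iterate_succ_apply] at this
    · intro h n
      cases n with
      | zero => exact hv
      | succ n =>
        rw [Function.iterate_succ_apply]
        exact h n
  have hS₀ : v₀ ∉ S := fun h => h 0 rfl
  refine Matrix.exists_mulVec_eq_zero_iff.1 ⟨S.indicator 1, ?_, ?_⟩
  · obtain ⟨v, hv⟩ := hS
    intro h
    have := congrFun h v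
    simp [hv] at this
  · ext v
    change arrowRow tgt v (f v) ⬝ᵥ S.indicator 1 = 0
    rw [arrowRow, sub_dotProduct, single_one_dotProduct]
    by_cases hv : v = v₀
    · subst hv
      simp [h₀, hS₀]
    · obtain ⟨d, hd⟩ := hf v hv
      have hgv : g v = tgt d := by simp [g, hd]
      have := hSg v hv
      rw [hgv] at this
      simp only [hd, Option.elim_some, single_one_dotProduct, Set.indicator_apply, this, Pi.one_apply,
        sub_self]

/-- The matrix-tree theorem. -/
theorem det_updateRow_dirLaplacian [Fintype V] [Fintype D] (src tgt : D → V) (v₀ : V) :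
    ((dirLaplacian src tgt).updateRow v₀ (Pi.single v₀ 1)).det =
      ({f | IsArborescence src tgt v₀ f}.ncard : ℂ) := by
  classical
  let A : V → Finset (Option D) := fun v =>
    if v = v₀ then {none} else ({d | src d = v} : Finset D).map Function.Embedding.some
  have hM : (dirLaplacian src tgt).updateRow v₀ (Pi.single v₀ 1) =
      fun v => ∑ o ∈ A v, arrowRow tgt v o := by
    funext v
    by_cases hv : v = v₀
    · subst hv
      rw [Matrix.updateRow_self]
      simp [A, arrowRow]
    · rw [Matrix.updateRow_ne hv]
      change ∑ d with src d = v, (Pi.single v 1 - Pi.single (tgt d) 1) = _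
      simp only [A, hv, if_false, sum_map, arrowRow, Function.Embedding.some_apply,
        Option.elim_some]
  -- Multilinearity in the rows expands the determinant over all choices of one outgoing arrow per
  -- non-root vertex.
  have hsum := (Matrix.detRowAlternating (n := V) (R := ℂ)).toMultilinearMap.map_sum_finset
    (fun v o => arrowRow tgt v o) A
  rw [hM]
  refine (hsum.trans ?_)
  have hA : ∀ f : V → Option D, f ∈ Fintype.piFinset A ↔
      f v₀ = none ∧ ∀ v, v ≠ v₀ → ∃ d, f v = some d ∧ src d = v := by
    intro f
    rw [Fintype.mem_piFinset]
    constructor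
    · intro h
      refine ⟨by simpa [A] using h v₀, fun v hv => ?_⟩
      obtain ⟨d, hd, hd'⟩ := by simpa [A, hv] using h v
      exact ⟨d, hd'.symm, hd⟩
    · rintro ⟨h₀, h⟩ v
      by_cases hv : v = v₀
      · simp [A, hv, h₀]
      · obtain ⟨d, hd, hd'⟩ := h v hv
        simp [A, hv, hd, hd']
  have hterm : ∀ f ∈ Fintype.piFinset A,
      Matrix.detRowAlternating.toMultilinearMap (fun v => arrowRow tgt v (f v)) =
        if IsArborescence src tgt v₀ f then (1 : ℂ) else 0 := by
    intro f hf
    obtain ⟨h₀, h⟩ := (hA f).1 hf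
    split_ifs with har
    · obtain ⟨-, -, δ, hδ⟩ := har
      exact det_arrowRow_of_rank tgt f δ hδ
    · refine det_arrowRow_of_not_rank tgt v₀ f h₀ (fun v hv => ?_) fun hδ => har ⟨h₀, h, hδ⟩
      obtain ⟨d, hd, -⟩ := h v hv
      exact ⟨d, hd⟩
  rw [sum_congr rfl hterm, sum_boole, Set.ncard_eq_toFinset_card']
  congr 2
  ext f
  simp only [mem_filter, hA, Set.mem_toFinset, Set.mem_ofPred_eq]
  exact ⟨fun h => h.2, fun h => ⟨⟨h.1, h.2.1⟩, h⟩⟩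

end MatrixTree

/-! ### Bass's determinant formula and its behaviour at u = 1 -/

section IharaBass

set_option linter.unusedSectionVars false

variable {V D : Type*} [Fintype V] [DecidableEq V] [Fintype D] [DecidableEq D]

theorem dirLaplacian_mulVec_one (src tgt : D → V) :
    (dirLaplacian src tgt).mulVec 1 = 0 := by
  ext v
  simp only [Matrix.mulVec, dotProduct, dirLaplacian, Matrix.of_apply, Finset.sum_apply,
    Pi.one_apply, mul_one, Pi.zero_apply]
  rw [sum_comm]
  exact sum_eq_zero fun d _ => by simp

/-- The entry is the determinant with row `w` replaced by e_v = e_w + (e_v - e_w). The second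
summand gives a matrix killing the all-ones vector, so the entry does not depend on `v`. -/
theorem adjugate_dirLaplacian (src tgt : D → V) (v w : V) :
    (dirLaplacian src tgt).adjugate v w =
      ({f | IsArborescence src tgt w f}.ncard : ℂ) := by
  rw [Matrix.adjugate_apply, ← det_updateRow_dirLaplacian]
  have h := Matrix.det_updateRow_add (dirLaplacian src tgt) w (Pi.single w 1)
    (Pi.single v 1 - Pi.single w 1)
  rw [add_sub_cancel] at h
  rw [h, add_eq_left]
  refine Matrix.exists_mulVec_eq_zero_iff.1 ⟨1, fun h => by simpa using congrFun h v, ?_⟩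
  ext x
  by_cases hx : x = w
  · subst hx
    rw [Matrix.mulVec, Matrix.updateRow_self, sub_dotProduct]
    simp
  · rw [Matrix.mulVec, Matrix.updateRow_ne hx]
    exact congrFun (dirLaplacian_mulVec_one src tgt) x

/-- The matrix of the relation "`e` may follow `d` in a path without backtracks". -/
def edgeMatrix (src tgt : D → V) (rev : D → D) : Matrix D D ℂ :=
  Matrix.of fun d e => if tgt d = src e ∧ e ≠ rev d then 1 else 0

/-- With S = `srcMatrix` and T = `tgtMatrix`, the product ST is the adjacency matrix, while TS is
the successor relation with backtracks allowed. -/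
def srcMatrix (src : D → V) : Matrix V D ℂ := Matrix.of fun v d => if src d = v then 1 else 0

def tgtMatrix (tgt : D → V) : Matrix D V ℂ := Matrix.of fun d v => if tgt d = v then 1 else 0

def revMatrix (rev : D → D) : Matrix D D ℂ := Matrix.of fun d e => if e = rev d then 1 else 0

/-- The matrix `(1 - u²) - u A + u² Δ`, with `A` the adjacency matrix and `Δ` the diagonal matrix
of the degrees. -/
def bassMatrix (src tgt : D → V) (u : ℂ) : Matrix V V ℂ :=
  (1 - u ^ 2) • 1 - u • (srcMatrix src * tgtMatrix tgt) +
    u ^ 2 • Matrix.diagonal fun v => (#{d | src d = v} : ℂ)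

theorem edgeMatrix_eq (src tgt : D → V) (rev : D → D) (hrev : ∀ d, src (rev d) = tgt d) :
    edgeMatrix src tgt rev = tgtMatrix tgt * srcMatrix src - revMatrix rev := by
  ext d e
  simp only [edgeMatrix, tgtMatrix, srcMatrix, revMatrix, Matrix.mul_apply, Matrix.of_apply,
    Matrix.sub_apply, ite_mul, one_mul, zero_mul, sum_ite_eq, mem_univ, if_true]
  by_cases he : e = rev d
  · simp [he, hrev]
  · simp [he, eq_comm]

theorem revMatrix_mul_self (rev : D → D) (hinv : ∀ d, rev (rev d) = d) :
    revMatrix rev * revMatrix rev = 1 := by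
  ext d e
  simp only [revMatrix, Matrix.mul_apply, Matrix.of_apply, ite_mul, one_mul, zero_mul,
    sum_ite_eq', mem_univ, if_true, hinv, Matrix.one_apply, eq_comm (a := d)]

theorem srcMatrix_mul_revMatrix_mul_tgtMatrix (src tgt : D → V) (rev : D → D)
    (hinv : ∀ d, rev (rev d) = d) (hrev : ∀ d, src (rev d) = tgt d) :
    srcMatrix src * (revMatrix rev * tgtMatrix tgt) =
      Matrix.diagonal fun v => (#{d | src d = v} : ℂ) := by
  have h : ∀ d, tgt (rev d) = src d := fun d => by rw [← hrev, hinv]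
  ext v w
  simp only [srcMatrix, revMatrix, tgtMatrix, Matrix.mul_apply, Matrix.of_apply, ite_mul, one_mul,
    zero_mul, sum_ite_eq', mem_univ, if_true, h, Matrix.diagonal_apply]
  rw [← sum_filter, sum_boole]
  split_ifs with hvw
  · subst hvw
    congr 2
    ext d
    simp
  · rw [filter_eq_empty_iff.2, card_empty, Nat.cast_zero]
    intro d hd
    rw [(mem_filter.1 hd).2]
    exact hvw

/-- Splitting the arrows by direction turns the matrix into the 2 × 2 block matrix with 1 on and u
off the diagonal. -/
theorem det_one_add_smul_revMatrix {E : Type*} [Fintype E] (ε : D ≃ E × Bool) (u : ℂ) :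
    (1 + u • revMatrix fun d => ε.symm ((ε d).1, !(ε d).2)).det =
      (1 - u ^ 2) ^ Fintype.card E := by
  classical
  let ψ : D ≃ E ⊕ E := ε.trans ((Equiv.prodComm E Bool).trans (Equiv.boolProdEquivSum E))
  have h : (1 + u • revMatrix fun d => ε.symm ((ε d).1, !(ε d).2)) =
      (Matrix.fromBlocks (1 : Matrix E E ℂ) (u • 1) (u • 1) 1).submatrix ψ ψ := by
    ext d e
    obtain ⟨⟨x, a⟩, rfl⟩ := ε.symm.surjective d
    obtain ⟨⟨y, b⟩, rfl⟩ := ε.symm.surjective e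
    cases a <;> cases b <;>
      simp [revMatrix, ψ, Equiv.boolProdEquivSum_apply, Matrix.one_apply, eq_comm (a := y)]
  rw [h, Matrix.det_submatrix_equiv_self, Matrix.det_fromBlocks_one₁₁]
  have : (1 - (u • 1) * (u • 1) : Matrix E E ℂ) = (1 - u ^ 2) • 1 := by
    rw [smul_mul_smul_comm, one_mul, ← sq, sub_smul, one_smul]
  rw [this, Matrix.det_smul, Matrix.det_one, mul_one]

/-- Bass's determinant formula. -/
theorem det_one_sub_smul_edgeMatrix (src tgt : D → V) (rev : D → D) (hinv : ∀ d, rev (rev d) = d)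
    (hrev : ∀ d, src (rev d) = tgt d) (u : ℂ) (hu : 1 - u ^ 2 ≠ 0) :
    (1 - u • edgeMatrix src tgt rev).det * (1 - u ^ 2) ^ Fintype.card V =
      (1 + u • revMatrix rev).det * (bassMatrix src tgt u).det := by
  set J := revMatrix rev
  set S := srcMatrix src
  set T := tgtMatrix tgt
  set c := 1 - u ^ 2 with hc
  have hJ : J * J = 1 := revMatrix_mul_self rev hinv
  have h1 : (1 + u • J) * (1 - u • J) = c • (1 : Matrix D D ℂ) := by
    rw [add_mul, mul_sub, mul_sub, smul_mul_smul_comm, hJ, hc, sub_smul, sq]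
    simp
  -- As J² = 1, the inverse of 1 + uJ is c⁻¹(1 - uJ). Factoring out 1 + uJ leaves 1 - XS with X of
  -- size D × V, and det(1 - XS) = det(1 - SX) moves the computation to vertices.
  have h2 : 1 - u • edgeMatrix src tgt rev =
      (1 + u • J) * (1 - ((c⁻¹ * u) • ((1 - u • J) * T)) * S) := by
    rw [edgeMatrix_eq src tgt rev hrev, mul_sub, mul_one, Matrix.smul_mul, Matrix.mul_smul,
      ← Matrix.mul_assoc, ← Matrix.mul_assoc, h1, Matrix.smul_mul, Matrix.smul_mul, smul_smul,
      Matrix.one_mul, mul_right_comm, inv_mul_cancel₀ hu, one_mul, smul_sub]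
    abel
  have h3 : c • (1 - S * ((c⁻¹ * u) • ((1 - u • J) * T))) = bassMatrix src tgt u := by
    rw [bassMatrix, ← srcMatrix_mul_revMatrix_mul_tgtMatrix src tgt rev hinv hrev, smul_sub,
      Matrix.mul_smul, smul_smul, ← mul_assoc, mul_inv_cancel₀ hu, one_mul, Matrix.sub_mul,
      Matrix.one_mul, Matrix.mul_sub, smul_sub, Matrix.smul_mul, Matrix.mul_smul, smul_smul, ← sq]
    abel
  rw [h2, Matrix.det_mul, Matrix.det_one_sub_mul_comm, ← h3, Matrix.det_smul]
  ring

/-- The cofactor of `1 - u` in the determinant of the Bass matrix. -/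
def bassCofactor (src tgt : D → V) (v₀ : V) (u : ℂ) : ℂ :=
  ((bassMatrix src tgt u).updateCol v₀ fun v => 1 + u - u * #{d | src d = v}).det

theorem srcMatrix_mul_tgtMatrix_apply (src tgt : D → V) (v w : V) :
    (srcMatrix src * tgtMatrix tgt) v w =
      ∑ d with src d = v, (Pi.single (tgt d) 1 : V → ℂ) w := by
  simp only [srcMatrix, tgtMatrix, Matrix.mul_apply, Matrix.of_apply, ite_mul, one_mul, zero_mul,
    sum_filter, Pi.single_apply, eq_comm (a := w)]

/-- Replacing column `v₀` by the sum of all columns preserves the determinant, and every row sum is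
divisible by 1 - u. -/
theorem det_bassMatrix (src tgt : D → V) (v₀ : V) (u : ℂ) :
    (bassMatrix src tgt u).det = (1 - u) * bassCofactor src tgt v₀ u := by
  have h := Matrix.det_updateCol_sum (bassMatrix src tgt u) v₀ 1
  rw [Pi.one_apply, one_smul] at h
  rw [← h, bassCofactor, ← Matrix.det_updateCol_smul]
  congr 2
  ext v
  have h1 : ∑ w, (srcMatrix src * tgtMatrix tgt) v w = #{d | src d = v} := by
    simp_rw [srcMatrix_mul_tgtMatrix_apply]
    rw [sum_comm]
    simp
  have h2 : ∑ w, (1 : Matrix V V ℂ) v w = 1 := by simp [Matrix.one_apply]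
  have h3 : ∑ w, Matrix.diagonal (fun v => (#{d | src d = v} : ℂ)) v w = #{d | src d = v} := by
    simp [Matrix.diagonal_apply]
  simp only [bassMatrix, Matrix.add_apply, Matrix.sub_apply, Matrix.smul_apply, Pi.one_apply,
    smul_eq_mul, sum_add_distrib, sum_sub_distrib, ← mul_sum, h1, h2, h3, Pi.smul_apply]
  ring

theorem bassMatrix_one (src tgt : D → V) : bassMatrix src tgt 1 = dirLaplacian src tgt := by
  ext v w
  simp only [bassMatrix, Matrix.add_apply, Matrix.sub_apply, Matrix.smul_apply,
    srcMatrix_mul_tgtMatrix_apply, dirLaplacian, Matrix.of_apply, Finset.sum_apply, Pi.sub_apply,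
    sum_sub_distrib, Matrix.diagonal_apply]
  by_cases h : v = w
  · subst h
    simp
    ring
  · simp [h, Pi.single_apply, Ne.symm h]

/-- Cramer's rule for the Laplacian with right-hand side 2 - deg v; the adjugate entries are all κ,
and the degrees sum to the number of arrows. -/
theorem bassCofactor_one (src tgt : D → V) (v₀ : V) (κ : ℕ)
    (hκ : ∀ v, {f | IsArborescence src tgt v f}.ncard = κ) :
    bassCofactor src tgt v₀ 1 = κ * (2 * Fintype.card V - Fintype.card D) := by
  have h : bassCofactor src tgt v₀ 1 = Matrix.cramer (dirLaplacian src tgt)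
      (fun v => 1 + 1 - 1 * #{d | src d = v}) v₀ := by
    rw [Matrix.cramer_apply, bassCofactor, bassMatrix_one]
  rw [h, Matrix.cramer_eq_adjugate_mulVec, Matrix.mulVec, dotProduct]
  simp only [adjugate_dirLaplacian, hκ, ← mul_sum, sum_sub_distrib, one_mul]
  congr 2
  · simp
    ring
  · rw [← Nat.cast_sum, ← card_eq_sum_card_fiberwise (fun _ _ => mem_coe.2 (mem_univ _))]
    rfl

theorem differentiable_det {n : Type*} [Fintype n] [DecidableEq n] {M : ℂ → Matrix n n ℂ}
    (hM : ∀ i j, Differentiable ℂ fun u => M u i j) : Differentiable ℂ fun u => (M u).det := by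
  simp_rw [Matrix.det_apply]
  refine Differentiable.fun_sum fun σ _ => Differentiable.fun_const_smul ?_ _
  exact Differentiable.fun_finsetProd fun i _ => hM _ _

theorem differentiable_bassCofactor (src tgt : D → V) (v₀ : V) :
    Differentiable ℂ (bassCofactor src tgt v₀) := by
  refine differentiable_det fun v w => ?_
  by_cases hw : w = v₀
  · subst hw
    simp only [Matrix.updateCol_self]
    fun_prop
  · simp only [Matrix.updateCol_ne hw, bassMatrix, Matrix.add_apply, Matrix.sub_apply,
      Matrix.smul_apply, smul_eq_mul]
    fun_prop

end IharaBass

/-! ### The logarithm of det(1 - uB) as a trace series -/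

section LogDet

variable {n : Type*} [Fintype n] [DecidableEq n]

/-- Jacobi's formula, from 1 - wB = (1 - uB)(1 - (w - u)RB) and the expansion det(1 + xM) = 1 + x tr
M + O(x²). -/
theorem hasDerivAt_det_one_sub_smul (B R : Matrix n n ℂ) (u : ℂ)
    (hR : (1 - u • B) * R = 1) :
    HasDerivAt (fun w : ℂ => (1 - w • B).det) (-((R * B).trace) * (1 - u • B).det) u := by
  set t := (-(R * B)).trace
  set q := (Matrix.det (1 + (Polynomial.X : Polynomial ℂ) •
    (-(R * B)).map Polynomial.C)).divX.divX
  have h : ∀ w : ℂ, (1 - w • B).det =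
      (1 - u • B).det * (1 + t * (w - u) + q.eval (w - u) * (w - u) ^ 2) := by
    intro w
    rw [← Matrix.det_one_add_smul, ← Matrix.det_mul]
    congr 1
    rw [mul_add, mul_one, Matrix.mul_smul, mul_neg, ← mul_assoc, hR, one_mul, sub_smul]
    simp only [smul_neg]
    abel
  have hd : HasDerivAt
      (fun x : ℂ => (1 - u • B).det * (1 + t * x + q.eval x * x ^ 2))
      ((1 - u • B).det * t) (u - u) := by
    rw [sub_self]
    have h1 : HasDerivAt (fun x : ℂ => 1 + t * x + q.eval x * x ^ 2) _ 0 :=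
      (((hasDerivAt_id (0 : ℂ)).const_mul t).const_add 1).add
        ((q.hasDerivAt 0).mul (hasDerivAt_pow 2 (0 : ℂ)))
    refine (h1.const_mul _).congr_deriv ?_
    simp
  have := hd.comp_sub_const u u
  simp_rw [← h] at this
  refine this.congr_deriv ?_
  rw [mul_comm, ← Matrix.trace_neg]

/-- The termwise derivative of the series is t(RB) with R the Neumann series of (1 - uB)⁻¹, so the
derivative of exp(S)·F vanishes on a ball. An abstract algebra postpones the choice of a matrix
norm. -/
theorem exists_exp_mul_eq_one {𝔸 : Type*} [NormedRing 𝔸] [NormedAlgebra ℂ 𝔸]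
    [FiniteDimensional ℂ 𝔸] (t : 𝔸 →ₗ[ℂ] ℂ) (B : 𝔸) (F : ℂ → ℂ) (hF0 : F 0 = 1)
    (hF : ∀ u R, (1 - u • B) * R = 1 → HasDerivAt F (-t (R * B) * F u) u) :
    ∃ ε : ℝ, 0 < ε ∧ ∀ u : ℂ, ‖u‖ < ε → ∃ S : ℂ,
      HasSum (fun k : ℕ => t (B ^ (k + 1)) * u ^ (k + 1) / (k + 1)) S ∧
        Complex.exp S * F u = 1 := by
  have : CompleteSpace 𝔸 := FiniteDimensional.complete ℂ 𝔸
  let τ : 𝔸 →L[ℂ] ℂ := LinearMap.toContinuousLinearMap t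
  have hτ : ∀ A, τ A = t A := fun A => rfl
  -- This radius ensures ‖uB‖ ≤ 1/2, which gives both the Neumann series and a uniform geometric
  -- bound on the derivatives.
  set ε : ℝ := (2 * (‖B‖ + 1))⁻¹ with hε
  have hB : 0 ≤ ‖B‖ := norm_nonneg B
  have hε0 : 0 < ε := by positivity
  have hεB : ‖B‖ * ε ≤ 1 / 2 := by
    rw [hε, ← div_eq_mul_inv, div_le_div_iff₀ (by positivity) (by norm_num)]
    linarith
  let g : ℕ → ℂ → ℂ := fun k u => t (B ^ (k + 1)) * u ^ (k + 1) / (k + 1)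
  let g' : ℕ → ℂ → ℂ := fun k u => t (B ^ (k + 1)) * u ^ k
  have hg : ∀ k, ∀ u ∈ Metric.ball (0 : ℂ) ε, HasDerivAt (g k) (g' k u) u := by
    intro k u _
    refine (((hasDerivAt_pow (k + 1) u).const_mul _).div_const _).congr_deriv ?_
    have : (k + 1 : ℂ) ≠ 0 := Nat.cast_add_one_ne_zero k
    simp only [g', Nat.cast_add, Nat.cast_one, Nat.add_sub_cancel]
    field_simp
  have hbound : ∀ k, ∀ u ∈ Metric.ball (0 : ℂ) ε, ‖g' k u‖ ≤ ‖τ‖ * ‖B‖ * (1 / 2) ^ k := by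
    intro k u hu
    rw [mem_ball_zero_iff] at hu
    have h1 : ‖t (B ^ (k + 1))‖ ≤ ‖τ‖ * ‖B‖ ^ (k + 1) :=
      (τ.le_opNorm _).trans
        (mul_le_mul_of_nonneg_left (norm_pow_le' B k.succ_pos) (norm_nonneg _))
    calc ‖g' k u‖ = ‖t (B ^ (k + 1))‖ * ‖u‖ ^ k := by simp [g']
      _ ≤ ‖τ‖ * ‖B‖ ^ (k + 1) * ε ^ k := by gcongr
      _ = ‖τ‖ * ‖B‖ * (‖B‖ * ε) ^ k := by ring
      _ ≤ _ := by gcongr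
  have hsu : Summable fun k : ℕ => ‖τ‖ * ‖B‖ * (1 / 2 : ℝ) ^ k :=
    (summable_geometric_of_lt_one (by norm_num) (by norm_num)).mul_left _
  have hpre := (convex_ball (0 : ℂ) ε).isPreconnected
  have h0 : (0 : ℂ) ∈ Metric.ball (0 : ℂ) ε := Metric.mem_ball_self hε0
  have hg0 : ∀ k, g k 0 = 0 := fun k => by simp [g]
  have hs0 : Summable fun k => g k 0 := by simp [hg0]
  have hderiv : ∀ u ∈ Metric.ball (0 : ℂ) ε,
      HasDerivAt (fun z => ∑' k, g k z) (∑' k, g' k u) u := fun u hu =>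
    hasDerivAt_tsum_of_isPreconnected hsu Metric.isOpen_ball hpre hg hbound h0 hs0 hu
  have hE : ∀ u ∈ Metric.ball (0 : ℂ) ε,
      HasDerivAt (fun z => Complex.exp (∑' k, g k z) * F z) 0 u := by
    intro u hu
    have hu' : ‖u • B‖ < 1 := by
      rw [norm_smul]
      rw [mem_ball_zero_iff] at hu
      have : ‖u‖ * ‖B‖ ≤ ε * ‖B‖ := by gcongr
      linarith
    have hsum : Summable fun i : ℕ => (u • B) ^ i :=
      HasSummableGeomSeries.summable_geometric_of_norm_lt_one _ hu'
    have htr : t ((∑' i : ℕ, (u • B) ^ i) * B) = ∑' k, g' k u := by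
      rw [← hsum.tsum_mul_right B, ← hτ, τ.map_tsum (hsum.mul_right B)]
      refine tsum_congr fun k => ?_
      rw [smul_pow, smul_mul_assoc, ← pow_succ, map_smul, hτ, smul_eq_mul, mul_comm]
    have hd := (hderiv u hu).cexp.mul
      (hF u _ (mul_neg_geom_series _ hu'))
    refine hd.congr_deriv ?_
    rw [htr]
    ring
  refine ⟨ε, hε0, fun u hu => ⟨∑' k, g k u, ?_, ?_⟩⟩
  · exact (summable_of_summable_hasDerivAt_of_isPreconnected hsu Metric.isOpen_ball hpre hg hbound
      h0 hs0 (mem_ball_zero_iff.2 hu)).hasSum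
  · have := Metric.isOpen_ball.is_const_of_deriv_eq_zero hpre
      (fun z hz => (hE z hz).differentiableAt.differentiableWithinAt)
      (fun z hz => (hE z hz).deriv) (mem_ball_zero_iff.2 hu) h0
    simpa [hg0, hF0] using this

attribute [local instance] Matrix.linftyOpNormedRing Matrix.linftyOpNormedAlgebra in
/-- `det (1 - uB)⁻¹ = exp (∑ tr (B ^ k) u ^ k / k)` for small `u`. -/
theorem exists_exp_mul_det_eq_one (B : Matrix n n ℂ) :
    ∃ ε : ℝ, 0 < ε ∧ ∀ u : ℂ, ‖u‖ < ε → ∃ S : ℂ,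
      HasSum (fun k : ℕ => (B ^ (k + 1)).trace * u ^ (k + 1) / (k + 1)) S ∧
        Complex.exp S * (1 - u • B).det = 1 :=
  exists_exp_mul_eq_one (Matrix.traceLinearMap n ℂ ℂ) B (fun u => (1 - u • B).det) (by simp)
    fun u R hR => hasDerivAt_det_one_sub_smul B R u hR

end LogDet

/-! ### Primitive words, powers and rotations -/

section Words

variable {D : Type*}

/-- A word which is not a proper power. -/
def IsPrimitiveWord (l : List D) : Prop :=
  l ≠ [] ∧ ∀ (c : List D) (a : ℕ), 2 ≤ a → l ≠ (List.replicate a c).flatten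

theorem flatten_replicate_add (c : List D) (i j : ℕ) :
    (List.replicate (i + j) c).flatten =
      (List.replicate i c).flatten ++ (List.replicate j c).flatten := by
  rw [List.replicate_add, List.flatten_append]

theorem flatten_replicate_succ (c : List D) (i : ℕ) :
    (List.replicate (i + 1) c).flatten = c ++ (List.replicate i c).flatten := by
  rw [List.replicate_succ, List.flatten_cons]

theorem length_flatten_replicate (c : List D) (i : ℕ) :
    (List.replicate i c).flatten.length = i * c.length := by
  simp

theorem flatten_replicate_flatten_replicate (c : List D) (i j : ℕ) :
    (List.replicate i (List.replicate j c).flatten).flatten =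
      (List.replicate (i * j) c).flatten := by
  induction i with
  | zero => simp
  | succ i ih => rw [flatten_replicate_succ, ih, Nat.succ_mul, Nat.add_comm, flatten_replicate_add]

/-- Commutation makes the shorter word `c` a prefix of `t`; cancelling it preserves commutation. -/
theorem eq_flatten_replicate_of_append_comm {c : List D} (j : ℕ) :
    ∀ t : List D, c ++ t = t ++ c → t.length = j * c.length →
      t = (List.replicate j c).flatten := by
  induction j with
  | zero =>
    intro t _ hl
    rw [Nat.zero_mul, List.length_eq_zero_iff] at hl
    simp [hl]
  | succ j ih =>
    intro t h hl
    have hle : c.length ≤ t.length := by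
      rw [hl]
      exact Nat.le_mul_of_pos_left _ j.succ_pos
    obtain ⟨t', rfl⟩ := List.prefix_of_prefix_length_le (List.prefix_append c t)
      (h ▸ List.prefix_append t c) hle
    rw [List.append_assoc, List.append_cancel_left_eq] at h
    rw [flatten_replicate_succ, ← ih t' h]
    rw [List.length_append, Nat.succ_mul] at hl
    lia

theorem iterate_rotate_one (l : List D) (n : ℕ) :
    (fun l : List D => l.rotate 1)^[n] l = l.rotate n := by
  induction n with
  | zero => simp
  | succ n ih => rw [Function.iterate_succ_apply', ih, List.rotate_rotate]

/-- The smallest rotation fixing a word. -/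
noncomputable def wordPeriod (l : List D) : ℕ := Function.minimalPeriod (fun l : List D => l.rotate 1) l

theorem wordPeriod_dvd {l : List D} {n : ℕ} (h : l.rotate n = l) : wordPeriod l ∣ n :=
  Function.IsPeriodicPt.minimalPeriod_dvd (by
    rw [Function.IsPeriodicPt, Function.IsFixedPt, iterate_rotate_one, h])

theorem rotate_wordPeriod (l : List D) : l.rotate (wordPeriod l) = l := by
  rw [← iterate_rotate_one]
  exact Function.isPeriodicPt_minimalPeriod _ l

theorem wordPeriod_dvd_length (l : List D) : wordPeriod l ∣ l.length :=
  wordPeriod_dvd l.rotate_length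

theorem wordPeriod_pos {l : List D} (hl : l ≠ []) : 0 < wordPeriod l :=
  Nat.pos_of_dvd_of_pos (wordPeriod_dvd_length l) (List.length_pos_of_ne_nil hl)

theorem wordPeriod_rotate {l : List D} (hl : l ≠ []) (n : ℕ) :
    wordPeriod (l.rotate n) = wordPeriod l := by
  rw [wordPeriod, ← iterate_rotate_one]
  exact Function.minimalPeriod_apply_iterate
    (Function.minimalPeriod_pos_iff_mem_periodicPts.1 (wordPeriod_pos hl)) n

/-- Invariance under rotation by `i` says that the first `i` letters commute with the remaining
ones. -/
theorem eq_flatten_replicate_take {l : List D} {i j : ℕ} (h : l.rotate i = l)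
    (hl : l.length = (j + 1) * i) : l = (List.replicate (j + 1) (l.take i)).flatten := by
  have hi : i ≤ l.length := hl ▸ Nat.le_mul_of_pos_left i j.succ_pos
  rw [List.rotate_eq_drop_append_take hi] at h
  have hcomm : l.take i ++ l.drop i = l.drop i ++ l.take i := by
    rw [List.take_append_drop, h]
  have hlen : (l.take i).length = i := by rw [List.length_take, min_eq_left hi]
  have := eq_flatten_replicate_of_append_comm j _ hcomm (by
    rw [hlen, List.length_drop, hl, Nat.succ_mul, Nat.add_sub_cancel])
  rw [flatten_replicate_succ, ← this, List.take_append_drop]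

theorem rotate_flatten_replicate (c : List D) (a : ℕ) :
    (List.replicate (a + 1) c).flatten.rotate c.length = (List.replicate (a + 1) c).flatten := by
  rw [flatten_replicate_succ, List.rotate_append_length_eq]
  conv_lhs =>
    rhs
    rw [← List.append_nil c, ← List.flatten_nil, ← List.replicate_zero (a := c),
      ← flatten_replicate_succ]
  rw [← flatten_replicate_add, flatten_replicate_succ]

/-- A period properly dividing the length exhibits a power, and a power is fixed by rotation through
its base. The criterion makes primitivity rotation invariant. -/
theorem isPrimitiveWord_iff {l : List D} (hl : l ≠ []) :
    IsPrimitiveWord l ↔ wordPeriod l = l.length := by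
  obtain ⟨j, hj⟩ := wordPeriod_dvd_length l
  have hpos := List.length_pos_of_ne_nil hl
  constructor
  · intro h
    rcases j with _ | _ | j
    · lia
    · lia
    · exact absurd (eq_flatten_replicate_take (rotate_wordPeriod l) (hj.trans (mul_comm _ _)))
        (h.2 _ _ (by lia))
  · refine fun h => ⟨hl, fun c a ha hc => ?_⟩
    obtain ⟨a, rfl⟩ : ∃ b, a = b + 2 := ⟨a - 2, by lia⟩
    have h1 : l.rotate c.length = l := by
      rw [hc]
      exact rotate_flatten_replicate c (a + 1)
    have h2 := wordPeriod_dvd h1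
    have h3 := congrArg List.length hc
    rw [length_flatten_replicate] at h3
    have hc0 : 0 < c.length := Nat.pos_of_ne_zero fun h0 => by
      rw [h0] at h3
      lia
    have := Nat.le_of_dvd hc0 h2
    nlinarith

theorem IsPrimitiveWord.rotate {l : List D} (h : IsPrimitiveWord l) (n : ℕ) :
    IsPrimitiveWord (l.rotate n) := by
  rw [isPrimitiveWord_iff (by simpa using h.1), wordPeriod_rotate h.1, List.length_rotate]
  exact (isPrimitiveWord_iff h.1).1 h

theorem wordPeriod_flatten_replicate {c : List D} (hc : IsPrimitiveWord c) (a : ℕ) :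
    wordPeriod (List.replicate (a + 1) c).flatten = c.length := by
  set w := (List.replicate (a + 1) c).flatten with hw
  have hwc : w = c ++ (List.replicate a c).flatten := flatten_replicate_succ c a
  have hc0 := List.length_pos_of_ne_nil hc.1
  obtain ⟨j, hj⟩ := wordPeriod_dvd (rotate_flatten_replicate c a)
  rw [← hw] at hj
  have hlen : w.length = (a + 1) * j * wordPeriod w := by
    rw [hw, length_flatten_replicate, ← hw, hj]
    ring
  obtain ⟨j, rfl⟩ : ∃ i, j = i + 1 := Nat.exists_eq_succ_of_ne_zero (by
    rintro rfl
    lia)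
  rcases j with _ | j
  · lia
  · exfalso
    -- A period p smaller than |c| cuts the word into copies of a prefix of length p. The first j +
    -- 2 of them make up `c`, contradicting primitivity.
    obtain ⟨m, hm⟩ : ∃ m, (a + 1) * (j + 1 + 1) = j + 1 + 1 + m := ⟨a * (j + 2), by ring⟩
    have h1 := eq_flatten_replicate_take (j := j + 1 + m) (rotate_wordPeriod w)
      (by rw [hlen, hm]; ring)
    rw [show j + 1 + m + 1 = j + 1 + 1 + m by ring, flatten_replicate_add] at h1
    set b := List.take (wordPeriod w) w with hb
    have hbl : b.length = wordPeriod w := by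
      rw [hb, List.length_take, min_eq_left]
      rw [hlen]
      exact Nat.le_mul_of_pos_left _ (by positivity)
    refine hc.2 b (j + 1 + 1) (by lia) ?_
    refine List.append_inj_left (hwc.symm.trans h1) ?_
    rw [length_flatten_replicate, hbl, hj, mul_comm]

theorem isPrimitiveWord_take_wordPeriod {w : List D} (hw : w ≠ []) :
    IsPrimitiveWord (w.take (wordPeriod w)) := by
  have hp := wordPeriod_pos hw
  have hlen : (w.take (wordPeriod w)).length = wordPeriod w := by
    rw [List.length_take, min_eq_left
      (Nat.le_of_dvd (List.length_pos_of_ne_nil hw) (wordPeriod_dvd_length w))]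
  refine ⟨List.ne_nil_of_length_pos (hp.trans_eq hlen.symm), fun c a ha hc => ?_⟩
  obtain ⟨j, hj⟩ := wordPeriod_dvd_length w
  have hw0 := List.length_pos_of_ne_nil hw
  obtain ⟨j, rfl⟩ : ∃ i, j = i + 1 := Nat.exists_eq_succ_of_ne_zero (by
    rintro rfl
    lia)
  have h := eq_flatten_replicate_take (rotate_wordPeriod w) (hj.trans (mul_comm _ _))
  rw [hc, flatten_replicate_flatten_replicate] at h
  obtain ⟨b, hb⟩ : ∃ b, (j + 1) * a = b + 1 := Nat.exists_eq_succ_of_ne_zero (by positivity)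
  rw [hb] at h
  have h1 : w.rotate c.length = w := by
    rw [h]
    exact rotate_flatten_replicate c b
  rw [hc, length_flatten_replicate] at hlen
  have hc0 : 0 < c.length := Nat.pos_of_ne_zero fun h0 => by
    rw [h0] at hlen
    lia
  have := Nat.le_of_dvd hc0 (wordPeriod_dvd h1)
  nlinarith

theorem exists_eq_flatten_replicate {w : List D} (hw : w ≠ []) :
    ∃ (c : List D) (k : ℕ), IsPrimitiveWord c ∧ w = (List.replicate (k + 1) c).flatten := by
  obtain ⟨j, hj⟩ := wordPeriod_dvd_length w
  have hw0 := List.length_pos_of_ne_nil hw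
  obtain ⟨j, rfl⟩ : ∃ i, j = i + 1 := Nat.exists_eq_succ_of_ne_zero (by
    rintro rfl
    lia)
  exact ⟨_, j, isPrimitiveWord_take_wordPeriod hw,
    eq_flatten_replicate_take (rotate_wordPeriod w) (hj.trans (mul_comm _ _))⟩

/-- Both |c| and |d| are the period of the common word, so both bases are the same prefix. -/
theorem IsPrimitiveWord.flatten_replicate_inj {c d : List D} (hc : IsPrimitiveWord c)
    (hd : IsPrimitiveWord d) {i j : ℕ}
    (h : (List.replicate (i + 1) c).flatten = (List.replicate (j + 1) d).flatten) :
    c = d ∧ i = j := by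
  have hl : c.length = d.length := by
    rw [← wordPeriod_flatten_replicate hc i, h, wordPeriod_flatten_replicate hd j]
  constructor
  · rw [flatten_replicate_succ, flatten_replicate_succ] at h
    exact List.append_inj_left h hl
  · have h1 := congrArg List.length h
    have hc0 := List.length_pos_of_ne_nil hc.1
    rw [length_flatten_replicate, length_flatten_replicate, ← hl] at h1
    have := Nat.eq_of_mul_eq_mul_right hc0 h1
    lia

theorem card_rotations {c : List D} (hc : IsPrimitiveWord c) :
    Nat.card {l : List D // (l : Cycle D) = c} = c.length := by
  have hp := (isPrimitiveWord_iff hc.1).1 hc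
  let φ : Fin c.length → {l : List D // (l : Cycle D) = c} :=
    fun i => ⟨c.rotate i, Cycle.coe_eq_coe.2 (List.IsRotated.symm ⟨i, rfl⟩)⟩
  have hφ : Function.Bijective φ := by
    constructor
    · intro i j hij
      have h := congrArg Subtype.val hij
      dsimp only [φ] at h
      rw [← iterate_rotate_one, ← iterate_rotate_one] at h
      exact Fin.ext (Function.iterate_injOn_Iio_minimalPeriod
        (i.2.trans_eq hp.symm) (j.2.trans_eq hp.symm) h)
    · rintro ⟨l, hl⟩
      obtain ⟨n, rfl⟩ := List.IsRotated.symm (Cycle.coe_eq_coe.1 hl)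
      exact ⟨⟨n % c.length, Nat.mod_lt _ (List.length_pos_of_ne_nil hc.1)⟩,
        Subtype.ext (List.rotate_mod c n)⟩
  rw [← Nat.card_congr (Equiv.ofBijective φ hφ), Nat.card_fin]

/-- The junction between two copies of `c` imposes the same condition as closing up a single copy.
-/
theorem chain_flatten_replicate (r : D → D → Prop) (c : List D) (k : ℕ) :
    Cycle.Chain r ((List.replicate (k + 1) c).flatten : Cycle D) ↔ Cycle.Chain r (c : Cycle D) := by
  rcases c with _ | ⟨x, c⟩
  · simp
  · rw [flatten_replicate_succ, List.cons_append, Cycle.chain_coe_cons, Cycle.chain_coe_cons]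
    induction k with
    | zero => simp
    | succ k ih =>
      rw [flatten_replicate_succ, List.append_assoc, List.cons_append, List.cons_append,
        ← List.cons_append, List.isChain_split, ih, List.cons_append, and_self]

end Words

/-! ### The Euler product of a relation on a finite type -/

section EulerProduct

set_option linter.unusedSectionVars false

variable {D : Type*} [Fintype D] [DecidableEq D] (r : D → D → Prop) [DecidableRel r]

/-- The transition matrix of a relation. -/
def relMatrix : Matrix D D ℂ := Matrix.of fun d e => if r d e then 1 else 0

theorem relMatrix_apply (d e : D) : relMatrix r d e = if r d e then 1 else 0 := rfl

/-- The words `l` of length `k` such that `d l e` is a chain. -/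
noncomputable def chainsBetween (k : ℕ) (d e : D) : Finset (List D) :=
  {l ∈ (List.finite_length_eq D k).toFinset | List.IsChain r (d :: (l ++ [e]))}

theorem mem_chainsBetween {k : ℕ} {d e : D} {l : List D} :
    l ∈ chainsBetween r k d e ↔ l.length = k ∧ List.IsChain r (d :: (l ++ [e])) := by
  simp [chainsBetween]

/-- `k` interior letters mean k + 1 transitions, whence the shift in the exponent. -/
theorem relMatrix_pow_apply (k : ℕ) (d e : D) :
    (relMatrix r ^ (k + 1)) d e = #(chainsBetween r k d e) := by
  induction k generalizing d with
  | zero =>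
    have : chainsBetween r 0 d e = if r d e then {[]} else ∅ := by
      ext l
      rw [mem_chainsBetween, List.length_eq_zero_iff]
      split_ifs with h
      · rw [mem_singleton]
        refine ⟨fun h => h.1, fun hl => ⟨hl, ?_⟩⟩
        subst hl
        simpa using h
      · simp only [notMem_empty, iff_false, not_and]
        rintro rfl
        simpa using h
    rw [this, zero_add, pow_one, relMatrix, Matrix.of_apply]
    split_ifs <;> simp
  | succ k ih =>
    have h : chainsBetween r (k + 1) d e =
        ({a | r d a} : Finset D).biUnion fun a => (chainsBetween r k a e).image (List.cons a) := by
      ext l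
      simp only [mem_chainsBetween, mem_biUnion, mem_filter, mem_univ, true_and, mem_image]
      constructor
      · rintro ⟨hl, hc⟩
        obtain ⟨a, l, rfl⟩ := List.exists_of_length_succ l hl
        rw [List.cons_append, List.isChain_cons_cons] at hc
        exact ⟨a, hc.1, l, ⟨Nat.succ_injective hl, hc.2⟩, rfl⟩
      · rintro ⟨a, ha, l, ⟨hl, hc⟩, rfl⟩
        rw [List.cons_append, List.isChain_cons_cons]
        exact ⟨by rw [List.length_cons, hl], ha, hc⟩
    rw [h, card_biUnion, pow_succ', Matrix.mul_apply]
    · simp only [card_image_of_injective _ List.cons_injective, ih, relMatrix_apply, ite_mul,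
        one_mul, zero_mul, ← sum_filter, Nat.cast_sum]
    · intro a _ b _ hab
      rw [Function.onFun, disjoint_left]
      simp only [mem_image]
      rintro _ ⟨l, _, rfl⟩ ⟨m, _, hm⟩
      exact hab (List.cons.inj hm).1.symm

/-- The closed chains of length `k + 1`. -/
noncomputable def closedChains (k : ℕ) : Finset (List D) :=
  univ.biUnion fun d => (chainsBetween r k d d).image (List.cons d)

theorem mem_closedChains {k : ℕ} {l : List D} :
    l ∈ closedChains r k ↔ l.length = k + 1 ∧ Cycle.Chain r (l : Cycle D) := by
  simp only [closedChains, mem_chainsBetween, mem_biUnion, mem_univ, true_and, mem_image]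
  constructor
  · rintro ⟨d, l, ⟨hl, hc⟩, rfl⟩
    exact ⟨by rw [List.length_cons, hl], (Cycle.chain_coe_cons r d l).2 hc⟩
  · rintro ⟨hl, hc⟩
    obtain ⟨a, l, rfl⟩ := List.exists_of_length_succ l hl
    exact ⟨a, l, ⟨Nat.succ_injective hl, (Cycle.chain_coe_cons r a l).1 hc⟩, rfl⟩

theorem card_closedChains (k : ℕ) :
    (#(closedChains r k) : ℂ) = (relMatrix r ^ (k + 1)).trace := by
  rw [closedChains, card_biUnion, Matrix.trace]
  · simp only [card_image_of_injective _ List.cons_injective, Matrix.diag_apply,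
      relMatrix_pow_apply, Nat.cast_sum]
  · intro a _ b _ hab
    rw [Function.onFun, disjoint_left]
    simp only [mem_image]
    rintro _ ⟨l, _, rfl⟩ ⟨m, _, hm⟩
    exact hab (List.cons.inj hm).1.symm

theorem summable_pow_length {x : ℝ} (hx : 0 ≤ x) (hx' : Fintype.card D * x < 1) :
    Summable fun l : List D => x ^ l.length := by
  rw [← (Equiv.sigmaFiberEquiv (List.length : List D → ℕ)).summable_iff]
  have hf : ∀ y : Σ n, {l : List D // l.length = n},
      ((fun l : List D => x ^ l.length) ∘ Equiv.sigmaFiberEquiv List.length) y = x ^ y.1 := by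
    rintro ⟨n, l, rfl⟩
    rfl
  rw [funext hf, summable_sigma_of_nonneg fun _ => pow_nonneg hx _]
  constructor
  · intro n
    have : Finite {l : List D // l.length = n} := (List.finite_length_eq D n).to_subtype
    exact Summable.of_finite
  · have h : ∀ n, ∑' _ : {l : List D // l.length = n}, x ^ n = (Fintype.card D * x) ^ n := by
      intro n
      have : Nat.card {l : List D // l.length = n} = Fintype.card D ^ n := by
        rw [← card_vector n, ← Nat.card_eq_fintype_card]
        rfl
      rw [tsum_const, this, nsmul_eq_mul, Nat.cast_pow, mul_pow]
    simp only [h]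
    exact summable_geometric_of_lt_one (by positivity) hx'

/-- The nonempty closed chains. -/
abbrev ClosedChain : Type _ := {l : List D // l ≠ [] ∧ Cycle.Chain r (l : Cycle D)}

/-- The cycles of primitive closed chains. -/
abbrev PrimeCycle : Type _ :=
  {c : Cycle D // ∃ l : List D, (IsPrimitiveWord l ∧ Cycle.Chain r (l : Cycle D)) ∧ (l : Cycle D) = c}

theorem exists_summable_closedChain : ∃ ε : ℝ, 0 < ε ∧ ∀ u : ℂ, ‖u‖ < ε → ‖u‖ < 1 ∧
    Summable fun w : ClosedChain r => u ^ w.1.length / (w.1.length : ℂ) := by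
  -- There are |D|^n words of length n, so |D|‖u‖ < 1 gives summability; the extra 1 also forces ‖u‖
  -- < 1.
  refine ⟨(Fintype.card D + 1 : ℝ)⁻¹, by positivity, fun u hu => ?_⟩
  have hu' : (Fintype.card D + 1) * ‖u‖ < 1 := by
    rwa [← lt_div_iff₀' (by positivity), one_div]
  have hu0 := norm_nonneg u
  constructor
  · nlinarith [(Nat.cast_nonneg (Fintype.card D) : (0 : ℝ) ≤ _)]
  refine .of_norm_bounded ((summable_pow_length (D := D) (norm_nonneg u)
    (by linarith)).comp_injective (Subtype.val_injective (p := fun l : List D =>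
      l ≠ [] ∧ Cycle.Chain r (l : Cycle D)))) fun w => ?_
  rw [norm_div, norm_pow, Complex.norm_natCast]
  refine div_le_self (by positivity) ?_
  exact_mod_cast List.length_pos_of_ne_nil w.2.1

theorem hasSum_trace_relMatrix {u s : ℂ}
    (h : HasSum (fun w : ClosedChain r => u ^ w.1.length / (w.1.length : ℂ)) s) :
    HasSum (fun k : ℕ => (relMatrix r ^ (k + 1)).trace * u ^ (k + 1) / (k + 1)) s := by
  let ψ : (Σ k : ℕ, {l // l ∈ closedChains r k}) → ClosedChain r := fun x =>
    ⟨x.2.1, List.ne_nil_of_length_eq_add_one ((mem_closedChains r).1 x.2.2).1,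
      ((mem_closedChains r).1 x.2.2).2⟩
  have hψ : Function.Bijective ψ := by
    constructor
    · rintro ⟨i, l, hl⟩ ⟨j, m, hm⟩ h
      have hlm : l = m := congrArg Subtype.val h
      subst hlm
      have h1 := ((mem_closedChains r).1 hl).1
      rw [((mem_closedChains r).1 hm).1] at h1
      obtain rfl : j = i := Nat.succ_injective h1
      rfl
    · rintro ⟨l, hl, hc⟩
      have := List.length_pos_of_ne_nil hl
      exact ⟨⟨l.length - 1, l, (mem_closedChains r).2 ⟨by lia, hc⟩⟩, rfl⟩
  rw [← (Equiv.ofBijective ψ hψ).hasSum_iff] at h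
  refine h.sigma fun k => ?_
  have hk : ∀ l : {l // l ∈ closedChains r k},
      ((fun w : ClosedChain r => u ^ w.1.length / (w.1.length : ℂ)) ∘ Equiv.ofBijective ψ hψ) ⟨k, l⟩ =
        u ^ (k + 1) / (k + 1) := by
    rintro ⟨l, hl⟩
    have := ((mem_closedChains r).1 hl).1
    change u ^ l.length / (l.length : ℂ) = _
    rw [this, Nat.cast_succ]
  rw [funext hk]
  convert! hasSum_fintype _ using 1
  rw [sum_const, card_univ, Fintype.card_coe, nsmul_eq_mul, card_closedChains, mul_div_assoc]

theorem PrimeCycle.of_coe_eq (p : PrimeCycle r) {l : List D} (hl : (l : Cycle D) = p.1) :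
    IsPrimitiveWord l ∧ Cycle.Chain r (l : Cycle D) := by
  obtain ⟨c, m, ⟨hm, hc⟩, rfl⟩ := p
  obtain ⟨n, rfl⟩ := List.IsRotated.symm (Cycle.coe_eq_coe.1 hl)
  exact ⟨hm.rotate n, by rwa [hl]⟩

theorem PrimeCycle.card_lists (p : PrimeCycle r) :
    Nat.card {l : List D // (l : Cycle D) = p.1} = Cycle.length p.1 := by
  obtain ⟨c, m, ⟨hm, hc⟩, rfl⟩ := p
  exact card_rotations hm

theorem PrimeCycle.length_pos (p : PrimeCycle r) : 0 < Cycle.length p.1 := by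
  obtain ⟨c, m, ⟨hm, hc⟩, rfl⟩ := p
  exact List.length_pos_of_ne_nil hm.1

/-- Closed chains are grouped by prime, exponent and rotation. The ν rotations cancel the ν in the
denominator (k + 1)ν, leaving the Taylor series of -log(1 - u^ν). -/
theorem hasSum_neg_log_primeCycle {u s : ℂ} (hu : ‖u‖ < 1)
    (h : HasSum (fun w : ClosedChain r => u ^ w.1.length / (w.1.length : ℂ)) s) :
    HasSum (fun p : PrimeCycle r => -Complex.log (1 - u ^ Cycle.length p.1)) s := by
  let φ : (Σ p : PrimeCycle r, ℕ × {l : List D // (l : Cycle D) = p.1}) → ClosedChain r :=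
    fun x => ⟨(List.replicate (x.2.1 + 1) x.2.2.1).flatten, by
      have := (PrimeCycle.of_coe_eq r x.1 x.2.2.2).1.1
      rw [flatten_replicate_succ]
      simp [this], (chain_flatten_replicate r _ _).2 (PrimeCycle.of_coe_eq r x.1 x.2.2.2).2⟩
  have hφ : Function.Bijective φ := by
    constructor
    · rintro ⟨⟨c, hp⟩, i, l, hl⟩ ⟨⟨d, hq⟩, j, m, hm⟩ h
      obtain ⟨rfl, rfl⟩ := (PrimeCycle.of_coe_eq r ⟨c, hp⟩ hl).1.flatten_replicate_inj
        (PrimeCycle.of_coe_eq r ⟨d, hq⟩ hm).1 (congrArg Subtype.val h)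
      dsimp only at hl hm
      subst hl
      subst hm
      rfl
    · rintro ⟨w, hw, hc⟩
      obtain ⟨c, k, hprim, rfl⟩ := exists_eq_flatten_replicate hw
      exact ⟨⟨⟨c, c, ⟨hprim, (chain_flatten_replicate r c k).1 hc⟩, rfl⟩, k, c, rfl⟩, rfl⟩
  rw [← (Equiv.ofBijective φ hφ).hasSum_iff] at h
  refine h.sigma fun p => ?_
  set ν := Cycle.length p.1 with hν
  have hν0 : 0 < ν := PrimeCycle.length_pos r p
  have hp : ∀ x : ℕ × {l : List D // (l : Cycle D) = p.1},
      ((fun w : ClosedChain r => u ^ w.1.length / (w.1.length : ℂ)) ∘ Equiv.ofBijective φ hφ) ⟨p, x⟩ =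
        (u ^ ν) ^ (x.1 + 1) / ((x.1 + 1 : ℕ) * ν) := by
    rintro ⟨k, l, hl⟩
    have hlν : l.length = ν := by
      rw [hν, ← hl]
      rfl
    change u ^ (List.replicate (k + 1) l).flatten.length /
      ((List.replicate (k + 1) l).flatten.length : ℂ) = _
    rw [length_flatten_replicate, hlν, Nat.cast_mul, ← pow_mul, mul_comm ν]
  have hs := h.summable.sigma_factor p
  rw [funext hp] at hs ⊢
  have hcard : Nat.card {l : List D // (l : Cycle D) = p.1} = ν := PrimeCycle.card_lists r p
  have hfin : Finite {l : List D // (l : Cycle D) = p.1} :=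
    Nat.finite_of_card_ne_zero (by rw [hcard]; exact hν0.ne')
  have hfib := hs.hasSum.prod_fiberwise fun k =>
    (Summable.of_finite (f := fun _ : {l : List D // (l : Cycle D) = p.1} =>
      (u ^ ν) ^ (k + 1) / (((k + 1 : ℕ) : ℂ) * ν))).hasSum
  have hlog := Complex.hasSum_taylorSeries_neg_log (z := u ^ ν) (by
    rw [norm_pow]
    exact pow_lt_one₀ (norm_nonneg u) hu hν0.ne')
  -- The Taylor series is indexed from 0, where its term is zero because division by 0 gives 0.
  rw [← hasSum_nat_add_iff' 1] at hlog
  have hk : ∀ k : ℕ, ∑' _ : {l : List D // (l : Cycle D) = p.1},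
      (u ^ ν) ^ (k + 1) / (((k + 1 : ℕ) : ℂ) * ν) = (u ^ ν) ^ (k + 1) / ((k + 1 : ℕ) : ℂ) := by
    intro k
    rw [tsum_const, hcard, nsmul_eq_mul]
    have : (ν : ℂ) ≠ 0 := Nat.cast_ne_zero.2 hν0.ne'
    field_simp
  rw [funext hk] at hfib
  have := hfib.unique hlog
  simp only [range_one, sum_singleton, Nat.cast_zero, div_zero, sub_zero] at this
  rw [← this]
  exact hs.hasSum

/-- The Euler product over the primitive closed chains of a relation on a finite type. -/
theorem exists_hasProd_primeCycle : ∃ ε : ℝ, 0 < ε ∧ ∀ u : ℂ, ‖u‖ < ε →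
    HasProd (fun p : PrimeCycle r => (1 - u ^ Cycle.length p.1)⁻¹)
      (1 - u • relMatrix r).det⁻¹ := by
  obtain ⟨ε₁, hε₁, h₁⟩ := exists_summable_closedChain r
  obtain ⟨ε₂, hε₂, h₂⟩ := exists_exp_mul_det_eq_one (relMatrix r)
  refine ⟨min ε₁ ε₂, lt_min hε₁ hε₂, fun u hu => ?_⟩
  obtain ⟨hu1, hs⟩ := h₁ u (hu.trans_le (min_le_left _ _))
  obtain ⟨S, hS, hdet⟩ := h₂ u (hu.trans_le (min_le_right _ _))
  rw [← (hasSum_trace_relMatrix r hs.hasSum).unique hS] at hdet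
  rw [← eq_inv_of_mul_eq_one_left hdet]
  convert! (hasSum_neg_log_primeCycle r hu1 hs.hasSum).cexp using 2 with p
  rw [Function.comp_apply, Complex.exp_neg, Complex.exp_log]
  intro h0
  have h1 : ‖u ^ Cycle.length p.1‖ < 1 := by
    rw [norm_pow]
    exact pow_lt_one₀ (norm_nonneg u) hu1 (PrimeCycle.length_pos r p).ne'
  rw [← sub_eq_zero.1 h0, norm_one] at h1
  exact lt_irrefl _ h1

end EulerProduct

/-! ### Oriented edges and paths in multigraphs -/

namespace Graph

universe u v

variable {α : Type u} {β : Type v} {G H : Graph α β}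

namespace Dart

@[simp] theorem rev_rev (d : G.Dart) : d.rev.rev = d := by
  cases d
  simp [rev]

@[simp] theorem src_rev (d : G.Dart) : d.rev.src = d.tgt := by
  obtain ⟨e, b⟩ := d
  cases b <;> rfl

@[simp] theorem tgt_rev (d : G.Dart) : d.rev.tgt = d.src := by
  obtain ⟨e, b⟩ := d
  cases b <;> rfl

theorem isLink (d : G.Dart) : G.IsLink d.edge d.src d.tgt := by
  obtain ⟨e, b⟩ := d
  cases b
  · exact (G.isLink_ref e).symm
  · exact G.isLink_ref e

theorem eq_or_eq_rev {d d' : G.Dart} (h : d.edge = d'.edge) : d = d' ∨ d = d'.rev := by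
  obtain ⟨e, b⟩ := d
  obtain ⟨e', b'⟩ := d'
  obtain rfl : e = e' := h
  cases b <;> cases b' <;> simp [rev]

/-- The initial vertex as an element of the vertex set. -/
noncomputable def vsrc (d : G.Dart) : G.vertexSet := ⟨d.src, d.isLink.left_mem⟩

/-- The terminal vertex as an element of the vertex set. -/
noncomputable def vtgt (d : G.Dart) : G.vertexSet := ⟨d.tgt, d.isLink.right_mem⟩

@[simp] theorem vsrc_rev (d : G.Dart) : d.rev.vsrc = d.vtgt := Subtype.ext d.src_rev

@[simp] theorem vtgt_rev (d : G.Dart) : d.rev.vtgt = d.vsrc := Subtype.ext d.tgt_rev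

end Dart

theorem IsLink.exists_dart {e : β} {x y : α} (h : G.IsLink e x y) :
    ∃ d : G.Dart, (d.edge : β) = e ∧ d.src = x ∧ d.tgt = y := by
  rcases (G.isLink_ref ⟨e, h.edge_mem⟩).eq_and_eq_or_eq_and_eq h with ⟨h1, h2⟩ | ⟨h1, h2⟩
  · exact ⟨⟨⟨e, h.edge_mem⟩, true⟩, rfl, h1, h2⟩
  · exact ⟨⟨⟨e, h.edge_mem⟩, false⟩, rfl, h2, h1⟩

theorem isPath_append {x z : α} {l m : List G.Dart} :
    G.IsPath x z (l ++ m) ↔ ∃ y, G.IsPath x y l ∧ G.IsPath y z m := by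
  induction l generalizing x with
  | nil => simp [IsPath]
  | cons d l ih => simp [IsPath, ih, and_assoc]

theorem IsPath.exists_reverse {x y : α} {l : List G.Dart} (h : G.IsPath x y l) :
    ∃ m, G.IsPath y x m := by
  induction l generalizing x with
  | nil => exact ⟨[], h.symm⟩
  | cons d l ih =>
    obtain ⟨m, hm⟩ := ih h.2
    exact ⟨m ++ [d.rev], isPath_append.2 ⟨_, hm, d.src_rev, d.tgt_rev.trans h.1⟩⟩

theorem IsPath.exists_tgt_eq {x y : α} {l : List G.Dart} (h : G.IsPath x y l) (hl : l ≠ []) :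
    ∃ d ∈ l, d.tgt = y := by
  induction l generalizing x with
  | nil => exact absurd rfl hl
  | cons d l ih =>
    rcases eq_or_ne l [] with rfl | hl'
    · exact ⟨d, by simp, h.2⟩
    · obtain ⟨e, he, hy⟩ := ih h.2 hl'
      exact ⟨e, List.mem_cons_of_mem d he, hy⟩

theorem IsPath.mono (hle : G ≤ H) {x y : α} {l : List G.Dart} (h : G.IsPath x y l) :
    ∃ m, H.IsPath x y m ∧ ∀ d ∈ m, (d.edge : β) ∈ G.edgeSet := by
  induction l generalizing x with
  | nil => exact ⟨[], h, by simp⟩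
  | cons d l ih =>
    obtain ⟨m, hm, hmem⟩ := ih h.2
    obtain ⟨d', he, hs, ht⟩ := (d.isLink.mono hle).exists_dart
    refine ⟨d' :: m, ⟨hs.trans h.1, ht ▸ hm⟩, ?_⟩
    rintro e (_ | ⟨_, he'⟩)
    · rw [he]
      exact d.edge.2
    · exact hmem e he'

theorem IsPath.exists_suffix {x y z : α} {l : List G.Dart} (h : G.IsPath z x l)
    (hnd : (z :: l.map Dart.tgt).Nodup) (hy : y ∈ z :: l.map Dart.tgt) :
    ∃ m, m ⊆ l ∧ G.IsPath y x m ∧ (y :: m.map Dart.tgt).Nodup := by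
  induction l generalizing z with
  | nil =>
    obtain rfl : y = z := by simpa using hy
    exact ⟨[], by simp, h, hnd⟩
  | cons d l ih =>
    rcases List.mem_cons.1 hy with rfl | hy
    · exact ⟨_, List.Subset.refl _, h, hnd⟩
    · obtain ⟨m, hm, hp, hn⟩ := ih h.2 (List.nodup_cons.1 hnd).2 hy
      exact ⟨m, List.subset_cons_of_subset d hm, hp, hn⟩

/-- Every path contains a path with the same ends that does not repeat a vertex. -/
theorem IsPath.exists_nodup {x y : α} {l : List G.Dart} (h : G.IsPath y x l) :
    ∃ m, m ⊆ l ∧ G.IsPath y x m ∧ (y :: m.map Dart.tgt).Nodup := by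
  induction l generalizing y with
  | nil => exact ⟨[], by simp, h, by simp⟩
  | cons d l ih =>
    obtain ⟨m, hm, hp, hn⟩ := ih h.2
    by_cases hy : y ∈ d.tgt :: m.map Dart.tgt
    · obtain ⟨m', hm', hp', hn'⟩ := hp.exists_suffix hn hy
      exact ⟨m', List.subset_cons_of_subset d (List.Subset.trans hm' hm), hp', hn'⟩
    · exact ⟨d :: m, List.cons_subset_cons d hm, ⟨h.1, hp⟩, List.nodup_cons.2 ⟨hy, hn⟩⟩

/-- Repeating the first edge in the same direction repeats its terminal vertex; traversing it
backwards returns to the start. -/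
theorem IsPath.nodup_edge {x y : α} {l : List G.Dart} (h : G.IsPath y x l)
    (hnd : (y :: l.map Dart.tgt).Nodup) : (l.map Dart.edge).Nodup := by
  induction l generalizing y with
  | nil => simp
  | cons d l ih =>
    rw [List.map_cons] at hnd
    obtain ⟨hy, hnd'⟩ := List.nodup_cons.1 hnd
    refine List.nodup_cons.2 ⟨fun hd => ?_, ih h.2 hnd'⟩
    obtain ⟨d', hd', he⟩ := List.mem_map.1 hd
    have hmem : d'.tgt ∈ l.map Dart.tgt := List.mem_map_of_mem hd'
    rcases Dart.eq_or_eq_rev he with rfl | rfl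
    · exact (List.nodup_cons.1 hnd').1 hmem
    · rw [Dart.tgt_rev, h.1] at hmem
      exact hy (List.mem_cons_of_mem _ hmem)

/-- A graph whose edges join vertices of different rank has no cycles if every vertex is the upper
end of at most one edge. -/
theorem not_isCycle_of_rank (δ : α → ℕ) (par : α → Option β)
    (h : ∀ e ∈ G.edgeSet, ∃ p q, G.IsLink e p q ∧ δ q < δ p ∧ par p = some e)
    (l : List G.Dart) : ¬ G.IsCycle l := by
  rintro ⟨⟨hl, x, hx⟩, hedge, -⟩
  have key : ∀ {e x y}, G.IsLink e x y → δ y ≤ δ x → par x = some e := by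
    intro e x y hxy hle
    obtain ⟨p, q, hpq, hlt, hp⟩ := h e hxy.edge_mem
    rcases hxy.eq_and_eq_or_eq_and_eq hpq with ⟨rfl, rfl⟩ | ⟨rfl, rfl⟩
    · exact hp
    · lia
  classical
  obtain ⟨d, hd, hmax⟩ := l.toFinset.exists_max_image (fun d : G.Dart => δ d.tgt) (by simpa using hl)
  rw [List.mem_toFinset] at hd
  obtain ⟨a, b, rfl⟩ := List.append_of_mem hd
  have hmax' : ∀ e ∈ b ++ a ++ [d], δ e.tgt ≤ δ d.tgt := fun e he =>
    hmax e (by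
      simp only [List.mem_append, List.mem_toFinset, List.mem_cons] at he ⊢
      tauto)
  obtain ⟨y, hy, hds, hb⟩ := isPath_append.1 hx
  have hm : G.IsPath d.tgt y (b ++ a) := isPath_append.2 ⟨x, hb, hy⟩
  rw [List.map_append, List.map_cons] at hedge
  have hd' : (d.edge ∉ (b ++ a).map Dart.edge) := by
    rw [List.map_append]
    exact fun hd' => (List.nodup_cons.1 ((List.perm_middle.nodup_iff).1 hedge)).1
      (by simpa [or_comm] using hd')
  -- The cycle is rotated so that `d`, with terminal vertex of maximal rank, comes last. An empty
  -- rest would make `d` a loop, against the strict rank drop. Otherwise that vertex is the upper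
  -- end of both `d` and the next edge, so the two edges coincide.
  rcases hba : b ++ a with _ | ⟨e, m⟩
  · rw [hba] at hm
    obtain ⟨p, q, hpq, hlt, -⟩ := h d.edge d.edge.2
    have hdl := d.isLink
    rw [hds, ← (hm : d.tgt = y)] at hdl
    rcases hdl.eq_and_eq_or_eq_and_eq hpq with ⟨h1, h2⟩ | ⟨h1, h2⟩ <;>
      rw [← h1, ← h2] at hlt <;> exact lt_irrefl _ hlt
  · obtain ⟨g, hg, hgy⟩ := hm.exists_tgt_eq (by simp [hba])
    have h1 : par d.tgt = some (d.edge : β) := by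
      refine key d.isLink.symm ?_
      rw [hds, ← hgy]
      exact hmax' g (List.mem_append_left _ hg)
    have h2 : par d.tgt = some (e.edge : β) := by
      rw [hba] at hm
      rw [← hm.1]
      refine key e.isLink ?_
      rw [hm.1]
      exact hmax' e (by simp [hba])
    refine hd' ?_
    rw [hba, List.map_cons, Subtype.ext (Option.some.inj (h1.symm.trans h2))]
    exact List.mem_cons_self

/-! ### Spanning trees as arborescences -/

section SpanningTree

/-- The edges used by a choice of oriented edges. -/
def parentEdges (f : G.vertexSet → Option G.Dart) : Set β :=
  {e | ∃ v d, f v = some d ∧ (d.edge : β) = e}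

theorem edgeSet_restrict_parentEdges (f : G.vertexSet → Option G.Dart) :
    (G.restrict (parentEdges f)).edgeSet = parentEdges f := by
  refine Set.inter_eq_right.2 ?_
  rintro e ⟨v, d, -, rfl⟩
  exact d.edge.2

theorem connected_of_root {v₀ : α} (h : ∀ x ∈ G.vertexSet, ∃ l, G.IsPath x v₀ l) :
    G.Connected := by
  intro x hx y hy
  obtain ⟨l, hl⟩ := h x hx
  obtain ⟨m, hm⟩ := h y hy
  obtain ⟨m', hm'⟩ := hm.exists_reverse
  exact ⟨l ++ m', isPath_append.2 ⟨v₀, hl, hm'⟩⟩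

theorem connected_restrict_parentEdges {v₀ : G.vertexSet} {f : G.vertexSet → Option G.Dart}
    (hf : IsArborescence Dart.vsrc Dart.vtgt v₀ f) :
    (G.restrict (parentEdges f)).Connected := by
  obtain ⟨-, hf, δ, hδ⟩ := hf
  refine connected_of_root (v₀ := v₀) fun x hx => ?_
  lift x to G.vertexSet using hx
  induction hn : δ x using Nat.strong_induction_on generalizing x with
  | _ n ih =>
    by_cases hx : x = v₀
    · exact ⟨[], congrArg Subtype.val hx⟩
    · obtain ⟨d, hd, hdx⟩ := hf x hx
      obtain ⟨l, hl⟩ := ih (δ d.vtgt) (hn ▸ hδ x d hd) d.vtgt rfl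
      have hlink : (G.restrict (parentEdges f)).IsLink d.edge d.src d.tgt :=
        ⟨⟨x, d, hd, rfl⟩, d.isLink⟩
      obtain ⟨d', -, hs, ht⟩ := hlink.exists_dart
      exact ⟨d' :: l, hs.trans (congrArg Subtype.val hdx), by rwa [ht]⟩

theorem isSpanningTree_restrict_parentEdges {v₀ : G.vertexSet} {f : G.vertexSet → Option G.Dart}
    (hf : IsArborescence Dart.vsrc Dart.vtgt v₀ f) :
    G.IsSpanningTree (G.restrict (parentEdges f)) := by
  classical
  refine ⟨⟨restrict_le, rfl⟩, connected_restrict_parentEdges hf, ?_⟩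
  obtain ⟨h₀, hf, δ, hδ⟩ := hf
  refine not_isCycle_of_rank (fun x => if hx : x ∈ G.vertexSet then δ ⟨x, hx⟩ else 0)
    (fun x => if hx : x ∈ G.vertexSet then (f ⟨x, hx⟩).map fun d => (d.edge : β) else none) ?_
  rintro e ⟨-, v, d, hd, rfl⟩
  have hv : v ≠ v₀ := by
    rintro rfl
    rw [h₀] at hd
    cases hd
  obtain ⟨d', hd', rfl⟩ := hf v hv
  obtain rfl : d' = d := Option.some.inj (hd'.symm.trans hd)
  refine ⟨d'.src, d'.tgt, ⟨⟨_, d', hd, rfl⟩, d'.isLink⟩, ?_, ?_⟩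
  · rw [dif_pos d'.isLink.left_mem, dif_pos d'.isLink.right_mem]
    exact hδ _ _ hd
  · rw [dif_pos d'.isLink.left_mem]
    exact congrArg (Option.map _) hd

/-- Induction on the rank for `f`. If `g` used the edge of `f v` in the opposite direction, at the
lower vertex `w`, then `f w = g w` would lead back up to `v`. -/
theorem eq_of_parentEdges_eq {v₀ : G.vertexSet} {f g : G.vertexSet → Option G.Dart}
    (hf : IsArborescence Dart.vsrc Dart.vtgt v₀ f) (hg : IsArborescence Dart.vsrc Dart.vtgt v₀ g)
    (h : parentEdges f = parentEdges g) : f = g := by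
  obtain ⟨hf₀, hf, δ, hδ⟩ := hf
  obtain ⟨hg₀, hg, -⟩ := hg
  funext v
  induction hn : δ v using Nat.strong_induction_on generalizing v with
  | _ n ih =>
    by_cases hv : v = v₀
    · rw [hv, hf₀, hg₀]
    · obtain ⟨d, hd, hdv⟩ := hf v hv
      have hmem : (d.edge : β) ∈ parentEdges g := h ▸ ⟨v, d, hd, rfl⟩
      obtain ⟨w, d', hd', he⟩ := hmem
      have hw : w ≠ v₀ := by
        rintro rfl
        rw [hg₀] at hd'
        cases hd'
      obtain ⟨d'', hd'', hdw⟩ := hg w hw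
      obtain rfl : d' = d'' := Option.some.inj (hd'.symm.trans hd'')
      rcases Dart.eq_or_eq_rev (Subtype.ext he) with rfl | rfl
      · rw [← hdv, hdw, ← hdw, hdv, hd, ← hdv, hdw, hd']
      · rw [Dart.vsrc_rev] at hdw
        have hlt : δ w < δ v := hdw ▸ hδ v d hd
        have hfw := (ih _ (hn ▸ hlt) w rfl).trans hd'
        have := hδ w _ hfw
        rw [Dart.vtgt_rev, hdv] at this
        lia

/-- The rank is the distance to `v₀` in `H`, and each vertex takes the first edge of a shortest
path. -/
theorem exists_isArborescence (hle : H.IsSpanningSubgraph G) (hH : H.Connected)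
    (v₀ : G.vertexSet) : ∃ f : G.vertexSet → Option G.Dart,
      IsArborescence Dart.vsrc Dart.vtgt v₀ f ∧ parentEdges f ⊆ H.edgeSet := by
  classical
  have hpath : ∀ v : G.vertexSet, ∃ n, ∃ l : List H.Dart, l.length = n ∧ H.IsPath v v₀ l := by
    intro v
    obtain ⟨l, hl⟩ := hH v (hle.vertexSet_eq.ge v.2) v₀ (hle.vertexSet_eq.ge v₀.2)
    exact ⟨_, l, rfl, hl⟩
  let δ : G.vertexSet → ℕ := fun v => Nat.find (hpath v)
  have hstep : ∀ v, v ≠ v₀ → ∃ d : G.Dart, d.vsrc = v ∧ δ d.vtgt < δ v ∧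
      (d.edge : β) ∈ H.edgeSet := by
    intro v hv
    obtain ⟨l, hl, hp⟩ := Nat.find_spec (hpath v)
    rcases l with _ | ⟨e, l⟩
    · exact absurd (Subtype.ext hp) hv
    · obtain ⟨d, hd, hs, ht⟩ := (e.isLink.mono hle.le).exists_dart
      refine ⟨d, Subtype.ext (hs.trans hp.1), ?_, hd ▸ e.edge.2⟩
      have := Nat.find_min' (hpath d.vtgt) ⟨l, rfl, by
        change H.IsPath d.tgt v₀ l
        rw [ht]
        exact hp.2⟩
      rw [List.length_cons] at hl
      dsimp only [δ]
      lia
  choose p hp using hstep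
  refine ⟨fun v => if hv : v = v₀ then none else some (p v hv), ⟨dif_pos rfl, fun v hv => ?_, δ, ?_⟩, ?_⟩
  · exact ⟨p v hv, dif_neg hv, (hp v hv).1⟩
  · intro v d hd
    by_cases hv : v = v₀
    · simp [hv] at hd
    · dsimp only at hd
      rw [dif_neg hv] at hd
      rw [← Option.some.inj hd]
      exact (hp v hv).2.1
  · rintro e ⟨v, d, hd, rfl⟩
    by_cases hv : v = v₀
    · simp [hv] at hd
    · dsimp only at hd
      rw [dif_neg hv] at hd
      rw [← Option.some.inj hd]
      exact (hp v hv).2.2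

/-- An edge of `H` missing from `S` would close up with a simple path in `S` between its ends to a
cycle of `H`; for a loop that path is empty. -/
theorem IsSpanningTree.edgeSet_subset (hG : G.IsSpanningTree H) {S : Graph α β}
    (hS : S.IsSpanningSubgraph H) (hconn : S.Connected) : H.edgeSet ⊆ S.edgeSet := by
  intro e he
  by_contra hSe
  obtain ⟨x, y, hxy⟩ := H.exists_isLink_of_mem_edgeSet he
  obtain ⟨l, hl⟩ := hconn y (hS.vertexSet_eq ▸ hxy.right_mem) x (hS.vertexSet_eq ▸ hxy.left_mem)
  obtain ⟨m, hm, hmem⟩ := hl.mono hS.le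
  obtain ⟨n, hn, hp, hnd⟩ := hm.exists_nodup
  obtain ⟨d, rfl, rfl, rfl⟩ := hxy.exists_dart
  refine hG.2.2 (d :: n) ⟨⟨by simp, d.src, rfl, hp⟩, ?_, hnd⟩
  refine List.nodup_cons.2 ⟨fun hd => ?_, hp.nodup_edge hnd⟩
  obtain ⟨d', hd', hdd⟩ := List.mem_map.1 hd
  exact hSe (hdd ▸ hmem d' (hn hd'))

theorem IsSpanningTree.exists_isArborescence (hH : G.IsSpanningTree H) (v₀ : G.vertexSet) :
    ∃ f : G.vertexSet → Option G.Dart, IsArborescence Dart.vsrc Dart.vtgt v₀ f ∧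
      G.restrict (parentEdges f) = H := by
  obtain ⟨f, hf, hfH⟩ := Graph.exists_isArborescence hH.1 hH.2.1 v₀
  refine ⟨f, hf, ?_⟩
  have hle : (G.restrict (parentEdges f)).IsSpanningSubgraph H := by
    refine ⟨⟨hH.1.vertexSet_eq.ge, fun e x y hxy => ?_⟩, hH.1.vertexSet_eq.symm⟩
    exact (hH.1.le.isLink_iff (hfH hxy.1)).2 hxy.2
  have hsub := hH.edgeSet_subset hle (connected_restrict_parentEdges hf)
  refine le_antisymm hle.le ⟨hH.1.vertexSet_eq.le, fun e x y hxy => ?_⟩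
  exact ⟨(hsub hxy.edge_mem).2, hxy.mono hH.1.le⟩

/-- A spanning tree has exactly one orientation towards `v₀`, so the count is independent of the
root, as `bassCofactor_one` requires. -/
theorem ncard_isArborescence (v₀ : G.vertexSet) :
    {f : G.vertexSet → Option G.Dart | IsArborescence Dart.vsrc Dart.vtgt v₀ f}.ncard =
      G.numSpanningTrees := by
  refine Set.ncard_congr (fun f _ => G.restrict (parentEdges f)) ?_ ?_ ?_
  · exact fun f hf => isSpanningTree_restrict_parentEdges hf
  · intro f g hf hg h
    refine eq_of_parentEdges_eq hf hg ?_
    rw [← edgeSet_restrict_parentEdges f, h, edgeSet_restrict_parentEdges]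
  · intro T hT
    obtain ⟨f, hf, h⟩ := IsSpanningTree.exists_isArborescence hT v₀
    exact ⟨f, hf, h⟩

theorem numSpanningTrees_ne_zero [Finite G.vertexSet] [Finite G.Dart] (hG : G.Connected)
    (v₀ : G.vertexSet) : G.numSpanningTrees ≠ 0 := by
  obtain ⟨f, hf, -⟩ := Graph.exists_isArborescence ⟨le_refl G, rfl⟩ hG v₀
  rw [← ncard_isArborescence v₀]
  exact (Set.ncard_pos (Set.toFinite _)).2 ⟨f, hf⟩ |>.ne'

end SpanningTree

end Graph

open Filter Topology

namespace Graph

universe u v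

variable {α : Type u} {β : Type v} {G : Graph α β}

/-! ### Prime paths as primitive closed chains -/

section PrimePaths

/-- `e` may follow `d` in a path without backtracks. -/
def Dart.Follows (d e : G.Dart) : Prop := d.vtgt = e.vsrc ∧ e ≠ d.rev

theorem isPath_iff_isChain (d e : G.Dart) (l : List G.Dart) :
    G.IsPath d.tgt e.src l ↔ List.IsChain (fun d e => d.vtgt = e.vsrc) (d :: (l ++ [e])) := by
  induction l generalizing d with
  | nil => simp [IsPath, Subtype.ext_iff, Dart.vtgt, Dart.vsrc]
  | cons a l ih =>
    rw [List.cons_append, List.isChain_cons_cons, ← ih, IsPath, Subtype.ext_iff, eq_comm]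
    rfl

theorem isClosedPath_cons_iff (d : G.Dart) (l : List G.Dart) :
    G.IsClosedPath (d :: l) ↔ List.IsChain (fun d e => d.vtgt = e.vsrc) (d :: (l ++ [d])) := by
  rw [← isPath_iff_isChain]
  constructor
  · rintro ⟨-, x, rfl, h⟩
    exact h
  · exact fun h => ⟨by simp, d.src, rfl, h⟩

theorem isChain_and_iff {D : Type*} {r s : D → D → Prop} (l : List D) :
    List.IsChain (fun a b => r a b ∧ s a b) l ↔ List.IsChain r l ∧ List.IsChain s l := by
  induction l with
  | nil => simp
  | cons a l ih =>
    cases l with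
    | nil => simp
    | cons b l =>
      rw [List.isChain_cons_cons, ih, List.isChain_cons_cons, List.isChain_cons_cons]
      tauto

/-- Having no tail is the no-backtrack condition at the cyclic junction. -/
theorem chain_follows_cons_iff (d : G.Dart) (l : List G.Dart) :
    Cycle.Chain Dart.Follows ((d :: l : List G.Dart) : Cycle G.Dart) ↔
      G.IsClosedPath (d :: l) ∧ List.IsChain (fun e f => f ≠ e.rev) (d :: l) ∧
        d ≠ ((d :: l).getLast (List.cons_ne_nil d l)).rev := by
  rw [Cycle.chain_coe_cons, isClosedPath_cons_iff]
  refine (isChain_and_iff _).trans (and_congr_right fun _ => ?_)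
  rw [← List.cons_append, List.isChain_append, List.getLast?_eq_some_getLast (List.cons_ne_nil d l)]
  simp

/-- Prime paths exclude only powers of closed paths, primitive words all powers. These agree since
the base of a closed chain is itself a closed chain. -/
theorem isPrimePath_iff (l : List G.Dart) :
    G.IsPrimePath l ↔ IsPrimitiveWord l ∧ Cycle.Chain Dart.Follows (l : Cycle G.Dart) := by
  rcases l with _ | ⟨d, l⟩
  · exact ⟨fun h => absurd rfl h.closed.1, fun h => absurd rfl h.1.1⟩
  · constructor
    · intro h
      have hc := (chain_follows_cons_iff d l).2 ⟨h.closed, h.no_backtrack, h.no_tail (by simp)⟩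
      refine ⟨⟨by simp, fun c a ha hca => ?_⟩, hc⟩
      obtain ⟨a, rfl⟩ : ∃ b, a = b + 1 := ⟨a - 1, by lia⟩
      refine h.primitive c (a + 1) ?_ ha hca
      rw [hca, chain_flatten_replicate] at hc
      rcases c with _ | ⟨e, c⟩
      · simp at hca
      · exact ((chain_follows_cons_iff e c).1 hc).1
    · rintro ⟨hp, hc⟩
      obtain ⟨h1, h2, h3⟩ := (chain_follows_cons_iff d l).1 hc
      exact ⟨h1, h2, fun _ => h3, fun c a _ ha => hp.2 c a ha⟩

/-- The primes of a graph as cycles of primitive closed chains. -/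
def primeEquiv (G : Graph α β) : G.Prime ≃ PrimeCycle (Dart.Follows (G := G)) :=
  Equiv.subtypeEquivRight fun c => by simp only [isPrimePath_iff]

end PrimePaths

/-- An oriented edge is an edge with a direction. -/
def dartEquiv (G : Graph α β) : G.Dart ≃ G.edgeSet × Bool where
  toFun d := (d.edge, d.dir)
  invFun x := ⟨x.1, x.2⟩
  left_inv _ := rfl
  right_inv _ := rfl

/-! ### The zeta function and its leading term at 1 -/

section Zeta

/-- Two zeta functions agree near any point, except possibly at it. -/
theorem IsIharaZeta.eventuallyEq {Z W : ℂ → ℂ} (hZ : G.IsIharaZeta Z) (hW : G.IsIharaZeta W)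
    (x : ℂ) : Z =ᶠ[𝓝[≠] x] W := by
  obtain ⟨mZ, ε, hε, hZ⟩ := hZ
  obtain ⟨mW, δ, hδ, hW⟩ := hW
  have h0 : ∀ᶠ u in 𝓝[≠] (0 : ℂ), (Z - W) u = 0 := by
    refine eventually_nhdsWithin_of_eventually_nhds ?_
    filter_upwards [Metric.ball_mem_nhds (0 : ℂ) (lt_min hε hδ)] with u hu
    rw [mem_ball_zero_iff] at hu
    rw [Pi.sub_apply, (hZ u (hu.trans_le (min_le_left _ _))).unique
      (hW u (hu.trans_le (min_le_right _ _))), sub_self]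
  have hm : MeromorphicOn (Z - W) Set.univ := fun u _ => (mZ u).sub (mW u)
  -- The difference vanishes near 0, and infinite order propagates over the connected plane.
  have hx : meromorphicOrderAt (Z - W) x = ⊤ := by
    by_contra hx
    exact hm.meromorphicOrderAt_ne_top_of_isPreconnected isPreconnected_univ (Set.mem_univ x)
      (Set.mem_univ 0) hx (meromorphicOrderAt_eq_top_iff.2 h0)
  filter_upwards [meromorphicOrderAt_eq_top_iff.1 hx] with u hu
  exact sub_eq_zero.1 hu

variable [DecidableEq G.vertexSet] [Fintype G.Dart] [DecidableEq G.Dart]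

/-- The reciprocal of the zeta function as a determinant. -/
noncomputable def edgeDet (G : Graph α β) [DecidableEq G.vertexSet] [Fintype G.Dart]
    [DecidableEq G.Dart] (u : ℂ) : ℂ :=
  (1 - u • edgeMatrix (Dart.vsrc (G := G)) Dart.vtgt Dart.rev).det

theorem differentiable_edgeDet : Differentiable ℂ G.edgeDet := by
  refine differentiable_det fun d e => ?_
  simp only [Matrix.sub_apply, Matrix.smul_apply, smul_eq_mul]
  fun_prop

theorem isIharaZeta_inv_edgeDet : G.IsIharaZeta G.edgeDet⁻¹ := by
  classical
  refine ⟨fun u => (differentiable_edgeDet.analyticAt u).meromorphicAt.inv, ?_⟩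
  obtain ⟨ε, hε, h⟩ := exists_hasProd_primeCycle (Dart.Follows (G := G))
  refine ⟨ε, hε, fun u hu => ?_⟩
  have hB : relMatrix (Dart.Follows (G := G)) = edgeMatrix Dart.vsrc Dart.vtgt Dart.rev := by
    ext d e
    rw [relMatrix_apply, edgeMatrix, Matrix.of_apply]
    exact if_congr Iff.rfl rfl rfl
  have := h u hu
  rw [hB, ← (primeEquiv G).hasProd_iff] at this
  exact this

theorem edgeDet_mul [Fintype G.vertexSet] [Fintype G.edgeSet] (v₀ : G.vertexSet) (u : ℂ) (hu : 1 - u ^ 2 ≠ 0) :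
    G.edgeDet u * (1 - u ^ 2) ^ Fintype.card G.vertexSet =
      (1 - u ^ 2) ^ Fintype.card G.edgeSet *
        ((1 - u) * bassCofactor (Dart.vsrc (G := G)) Dart.vtgt v₀ u) := by
  rw [edgeDet, det_one_sub_smul_edgeMatrix Dart.vsrc Dart.vtgt Dart.rev Dart.rev_rev Dart.vsrc_rev
    u hu, ← det_bassMatrix, ← det_one_add_smul_revMatrix G.dartEquiv]
  rfl

/-- The leading term of the reciprocal of the zeta function at `1`. -/
theorem exists_edgeDet_eventuallyEq [Fintype G.vertexSet] [Fintype G.edgeSet]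
    (v₀ : G.vertexSet) :
    ∃ g : ℂ → ℂ, AnalyticAt ℂ g 1 ∧
      g 1 = (-1) ^ (G.cycleRank + 1) * 2 ^ G.cycleRank * ((G.cycleRank : ℂ) - 1) *
        (G.numSpanningTrees : ℂ) ∧
      G.edgeDet =ᶠ[𝓝[≠] 1] fun u => (u - 1) ^ G.cycleRank • g u := by
  set b := bassCofactor (Dart.vsrc (G := G)) Dart.vtgt v₀ with hb
  have hr : G.cycleRank = (Fintype.card G.edgeSet : ℤ) - Fintype.card G.vertexSet + 1 := by
    rw [cycleRank, Set.ncard_eq_toFinset_card', Set.ncard_eq_toFinset_card', Set.toFinset_card,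
      Set.toFinset_card]
  set r := G.cycleRank
  have hD : Fintype.card G.Dart = 2 * Fintype.card G.edgeSet := by
    rw [Fintype.card_congr G.dartEquiv, Fintype.card_prod, Fintype.card_bool, mul_comm]
  -- From 1 - u² = -(u - 1)(1 + u): the sign (-1)^(r-1) combines with that of 1 - u = -(u - 1).
  -- Integer powers cover trees, where r - 1 = -1.
  refine ⟨fun u => (-1) ^ r * (1 + u) ^ (r - 1) * b u, ?_, ?_, ?_⟩
  · refine (analyticAt_const.mul (AnalyticAt.fun_zpow (by fun_prop) (by norm_num))).mul ?_
    exact (differentiable_bassCofactor _ _ v₀).analyticAt 1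
  · have h2 : (2 : ℂ) ≠ 0 := two_ne_zero
    have hb1 : b 1 = -2 * ((r : ℂ) - 1) * G.numSpanningTrees := by
      rw [hb, bassCofactor_one _ _ v₀ _ ncard_isArborescence, hD, hr]
      push_cast
      ring
    dsimp only
    rw [hb1, one_add_one_eq_two, zpow_add_one₀ (by norm_num), zpow_sub_one₀ h2]
    field_simp
  · have hne : ∀ᶠ u : ℂ in 𝓝[≠] 1, u ≠ -1 :=
      eventually_nhdsWithin_of_eventually_nhds
        (isOpen_ne.mem_nhds (by norm_num : (1 : ℂ) ≠ -1))
    filter_upwards [hne, self_mem_nhdsWithin] with u hu hu1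
    have hu2 : 1 + u ≠ 0 := fun h => hu (eq_neg_of_add_eq_zero_right h)
    have hu3 : u - 1 ≠ 0 := sub_ne_zero.2 hu1
    have hfac : 1 - u ^ 2 = (-1) * (u - 1) * (1 + u) := by ring
    have hu4 : 1 - u ^ 2 ≠ 0 := by
      rw [hfac]
      exact mul_ne_zero (mul_ne_zero (by norm_num) hu3) hu2
    have h := edgeDet_mul v₀ u hu4
    rw [← eq_div_iff (pow_ne_zero _ hu4), mul_comm _ ((1 - u) * _), mul_div_assoc,
      ← zpow_natCast (1 - u ^ 2), ← zpow_natCast (1 - u ^ 2), ← zpow_sub₀ hu4,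
      show (Fintype.card G.edgeSet : ℤ) - Fintype.card G.vertexSet = r - 1 by lia, hfac, mul_zpow,
      mul_zpow, zpow_sub_one₀ hu3, zpow_sub_one₀ (by norm_num : (-1 : ℂ) ≠ 0)] at h
    rw [h, smul_eq_mul, ← hb]
    have : (1 - u) = -(u - 1) := by ring
    rw [this]
    field_simp

end Zeta

end Graph

theorem mainTheorem7 {α : Type*} {β : Type*} (X : Graph α β)
    (hV : X.vertexSet.Finite) (hE : X.edgeSet.Finite) (hconn : X.Connected)
    (hdeg : ∀ x ∈ X.vertexSet, X.degree x ≠ 1) (hr : X.cycleRank ≠ 1) :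
    (∃ Z : ℂ → ℂ, X.IsIharaZeta Z) ∧
    ∀ Z : ℂ → ℂ, X.IsIharaZeta Z →
      meromorphicOrderAt Z⁻¹ 1 = (X.cycleRank : WithTop ℤ) ∧
      meromorphicTrailingCoeffAt Z⁻¹ 1 =
        (-1 : ℂ) ^ (X.cycleRank + 1) * (2 : ℂ) ^ X.cycleRank * ((X.cycleRank : ℂ) - 1) *
          (X.numSpanningTrees : ℂ) := by
  classical
  have := hV.fintype
  have := hE.fintype
  have := Fintype.ofEquiv _ X.dartEquiv.symm
  -- The empty graph has r = 1, which is excluded.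
  have hne : X.vertexSet.Nonempty := by
    by_contra h
    rw [Set.not_nonempty_iff_eq_empty] at h
    have hE : X.edgeSet = ∅ := by
      refine Set.eq_empty_of_forall_notMem fun e he => ?_
      have := (X.isLink_ref ⟨e, he⟩).left_mem
      rwa [h] at this
    exact hr (by simp [Graph.cycleRank, h, hE])
  obtain ⟨v₀, hv₀⟩ := hne
  have hζ : X.IsIharaZeta X.edgeDet⁻¹ := Graph.isIharaZeta_inv_edgeDet
  refine ⟨⟨_, hζ⟩, fun Z hZ => ?_⟩
  obtain ⟨g, hg, hg1, hgeq⟩ := X.exists_edgeDet_eventuallyEq ⟨v₀, hv₀⟩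
  have hg0 : g 1 ≠ 0 := by
    rw [hg1]
    refine mul_ne_zero (mul_ne_zero (mul_ne_zero ?_ ?_) ?_) ?_
    · exact zpow_ne_zero _ (by norm_num)
    · exact zpow_ne_zero _ two_ne_zero
    · exact sub_ne_zero.2 (by exact_mod_cast hr)
    · exact Nat.cast_ne_zero.2 (Graph.numSpanningTrees_ne_zero hconn ⟨v₀, hv₀⟩)
  have hZg : Z⁻¹ =ᶠ[𝓝[≠] 1] fun u => (u - 1) ^ X.cycleRank • g u := by
    have h := (hZ.eventuallyEq hζ 1).inv
    rw [inv_inv] at h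
    exact h.trans hgeq
  refine ⟨?_, ?_⟩
  · exact (meromorphicOrderAt_eq_int_iff (hZ.1 1).inv).2 ⟨g, hg, hg0, hZg⟩
  · rw [hg.meromorphicTrailingCoeffAt_of_ne_zero_of_eq_nhdsNE hg0 hZg, hg1]
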